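/- **Setting.** A Turing machine has a finite state set $Q$, a finite symbol set $\Gamma$ with a blank, an initial state, a two-way infinite tape and a partial transition function $\delta : Q\times\Gamma \rightharpoonup Q\times\Gamma\times\{L,R\}$; it halts where $\delta$ is undefined. It is an $(m,n)$-*universal Turing machine* (UTM) if $|Q|=m$, $|\Gamma|=n$, and it simulates every Turing machine: there are primitive recursive maps $\mathrm{enc}$ and $\mathrm{dec}$ such that, for every Turing machine $P$ (given as a list of quintuples) and input word $w$, the machine started in its initial state on the finite tape content $\mathrm{enc}(P,w)$ halts if and only if $P$ halts on $w$, and then $\mathrm{dec}$ applied to its final tape content gives the halting configuration of $P$. **The game.** Consider a session of *Civilization: Beyond Earth* with one player, no turn limit, and an infinite hexagonal map. Workers build a Road (on any unimproved tile) in $M\ge 1$ turns and a Terrascape (on an unimproved tile owned by the player) in $T\ge 1$ turns, and repair or remove an improvement in one turn; a Rover pillages a Road in one turn; in each turn every unit may first move to an adjacent tile. Suppose that * there is a bi-infinite strip $(h_i)_{i\in\mathbb Z}$ of distinct, flat, traversable tiles with $h_i$ adjacent to $h_{i+1}$ (the tape); * there is a finite connected section of the map, disjoint from the strip, that consists of flat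 desert tiles owned by the player, and at least nine of its tiles are worked by Citizens; * the player has the technology for building Terrascapes, can maintain at least nine of them, and has the Ecoscaping civic ($+1$ Culture per Terrascape); * apart from Terrascapes the Culture yield per turn is a constant $C_*$. Let $u\ge 1$ be the Culture yield of a worked Terrascape on desert, and $C_t$ the Culture yield of turn $t$. Let the machine $\mathcal M$ have states $Q=\{0,\dots,9\}$, initial state $0$, symbols $\Gamma=\{\text{No Improvement},\text{Road},\text{Pillaged Road}\}$ (written $0,1,b$; blank $0$), and the following transitions, where "$a'\,D\,q'$" in row $q$ and column $a$ means: write $a'$, move to $D$, go to state $q'$. | $q$ | $0$ | $1$ | $b$ | |---|---|---|---| | 0 | $1R0$ | $0L1$ | $bR3$ | | 1 | $0L2$ | $0L1$ | $bL1$ | | 2 | $0L1$ | $bL5$ | $bR0$ | | 3 | $1R0$ | $1R4$ | $1L3$ | | 4 | $bL2$ | $1R4$ | $bR4$ | | 5 | $1L6$ | $1L5$ | $bL5$ | | 6 | $0R7$ | HALT | $bL8$ | | 7 | $1L5$ | $1R7$ | $bR7$ | | 8 | $1L9$ | $0R9$ | $0L3$ | | 9 | $0R4$ | $0R9$ | $bR8$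 | In the game, an entry is the command: the tape Worker and the Rover change the tile under them as prescribed (build, remove or repair a Road; pillage it; build and pillage it; or leave the tile as it is) and move one tile along the strip in direction $D$, and the state Worker builds $q'-q$ Terrascapes, or removes $q-q'$. A game state *represents* a configuration of $\mathcal M$ if the normalized Culture yield $(C_t-C_*)/u$ is its state, the improvement on $h_i$ is its $i$-th tape symbol for every $i$, the tape Worker and the Rover are on the tile of the head, and the state Worker is in the state section, whose worked tiles carry only Terrascapes or nothing and which are the only tiles with Terrascapes. **Theorem.** Under these assumptions: 1. $\mathcal M$ is a $(10,3)$-universal Turing machine. 2. The command table corresponds, entry by entry, to the program above of Rogozhin's $(10,3)$-machine over $\{0,1,b\}$, under No Improvement $\mapsto 0$, Road $\mapsto 1$, Pillaged Road $\mapsto b$. 3. Every initial configuration of $\mathcal M$ (state $0$, finite tape content) is represented by a game state in which the state section is unimproved. 4. There is a constant $K$, depending only on the session, such that whenever a game state represents a configuration $c$ of $\mathcal M$ and $\mathcal M$ steps from $c$ to $c'$, the player can reach, by legal turns in which the units only move or carry out the command of the table for $c$, a game state that represents $c'$, within at most $K$ turns, of which at most $5T+M$ are turns in which some unit works. -/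

import Mathlib

namespace CivBE

/-! ### Turing machines -/

/-- Head movements. -/
inductive Dir
  | L
  | R
  deriving DecidableEq

/-- The cell reached from cell `i`. -/
def Dir.shift : Dir → ℤ → ℤ
  | .L, i => i - 1
  | .R, i => i + 1

/-- A Turing machine with states `Q` and tape symbols `Γ`. The transition function is partial;
the machine halts where it is undefined (final states are states without transitions). -/
structure TuringMachine (Q Γ : Type) where
  δ : Q → Γ → Option (Q × Γ × Dir)
  blank : Γ
  start : Q

/-- A configuration: internal state, head position, content of the two-way infinite tape. -/
structure Cfg (Q Γ : Type) where
  state : Q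
  head : ℤ
  tape : ℤ → Γ

namespace TuringMachine

variable {Q Γ : Type}

/-- One step; `none` means that the machine has halted. -/
def step (M : TuringMachine Q Γ) (c : Cfg Q Γ) : Option (Cfg Q Γ) :=
  (M.δ c.state (c.tape c.head)).map fun (q, a, d) =>
    { state := q, head := d.shift c.head, tape := Function.update c.tape c.head a }

/-- The initial configuration on the finite tape content `x = (l, r)`: `r` is written from the head
rightwards (its first symbol is under the head), `l` from the cell left of the head leftwards, and
all the other cells are blank. -/
def init (M : TuringMachine Q Γ) (x : List Γ × List Γ) : Cfg Q Γ where
  state := M.start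
  head := 0
  tape i := if 0 ≤ i then x.2.getD i.toNat M.blank else x.1.getD (-i - 1).toNat M.blank

/-- The configuration `c` has the tape content `x = (l, r)` relative to its head. -/
def HasContent (M : TuringMachine Q Γ) (c : Cfg Q Γ) (x : List Γ × List Γ) : Prop :=
  ∀ i : ℕ, c.tape (c.head + i) = x.2.getD i M.blank ∧
    c.tape (c.head - 1 - i) = x.1.getD i M.blank

/-- `d` is the halting configuration that `M` reaches from `c`. -/
def HaltsAt (M : TuringMachine Q Γ) (c d : Cfg Q Γ) : Prop :=
  Relation.ReflTransGen (fun a b => M.step a = some b) c d ∧ M.step d = none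

end TuringMachine

/-- `Dir` as a two-element type. -/
def Dir.equivBool : Dir ≃ Bool where
  toFun
    | .L => false
    | .R => true
  invFun
    | false => .L
    | true => .R
  left_inv := by rintro (_ | _) <;> rfl
  right_inv := by rintro (_ | _) <;> rfl

instance : Primcodable Dir := Primcodable.ofEquiv Bool Dir.equivBool

/-- An arbitrary Turing machine as a finite object: a list of quintuples `((q, a), (q', a', d))`
(in state `q` reading `a`: go to state `q'`, write `a'`, move to `d`). States and symbols are
numbered; the initial state and the blank are numbered `0`. The first quintuple that
applies counts, and the machine halts when none does. -/
abbrev Program := List ((ℕ × ℕ) × (ℕ × ℕ × Dir))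

/-- The Turing machine described by a list of quintuples. -/
def Program.machine (p : Program) : TuringMachine ℕ ℕ where
  δ q a := p.lookup (q, a)
  blank := 0
  start := 0

/-- `U` simulates every Turing machine: a primitive recursive `enc` translates a machine `p` and an
input word `w` for it into a finite tape content for `U`, such that `U`, started there in its
initial state, halts if and only if `p` halts on `w`; and a primitive recursive `dec` then recovers
the halting configuration of `p` (state and tape content relative to the head) from the
tape content with which `U` halts. -/
def IsUniversal {Q Γ : Type} [Primcodable Γ] (U : TuringMachine Q Γ) : Prop :=
  ∃ (enc : Program × List ℕ → List Γ × List Γ)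
    (dec : List Γ × List Γ → ℕ × List ℕ × List ℕ),
    Primrec enc ∧ Primrec dec ∧
    ∀ (p : Program) (w : List ℕ),
      ((∃ d, U.HaltsAt (U.init (enc (p, w))) d) ↔
        ∃ c, p.machine.HaltsAt (p.machine.init ([], w)) c) ∧
      ∀ c d, p.machine.HaltsAt (p.machine.init ([], w)) c →
        U.HaltsAt (U.init (enc (p, w))) d →
        ∀ x, U.HasContent d x →
          c.state = (dec x).1 ∧ p.machine.HasContent c (dec x).2

/-- An `(m, n)`-universal Turing machine: `m` states, `n` tape symbols, universal. -/
def IsUTM (m n : ℕ) {Q Γ : Type} [Primcodable Γ] (U : TuringMachine Q Γ) : Prop :=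
  Nat.card Q = m ∧ Nat.card Γ = n ∧ IsUniversal U

/-! ### Rogozhin's machine -/

/-- Tape symbols of Rogozhin's machine. -/
inductive RSymbol
  | zero
  | one
  | b
  deriving DecidableEq

open Dir RSymbol in
/-- Rogozhin's program with 10 states and 3 symbols (blank `0`). -/
def rogozhin : TuringMachine (Fin 10) RSymbol where
  δ
    | 0, zero => some (0, one, R)
    | 0, one => some (1, zero, L)
    | 0, b => some (3, b, R)
    | 1, zero => some (2, zero, L)
    | 1, one => some (1, zero, L)
    | 1, b => some (1, b, L)
    | 2, zero => some (1, zero, L)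
    | 2, one => some (5, b, L)
    | 2, b => some (0, b, R)
    | 3, zero => some (0, one, R)
    | 3, one => some (4, one, R)
    | 3, b => some (3, one, L)
    | 4, zero => some (2, b, L)
    | 4, one => some (4, one, R)
    | 4, b => some (4, b, R)
    | 5, zero => some (6, one, L)
    | 5, one => some (5, one, L)
    | 5, b => some (5, b, L)
    | 6, zero => some (7, zero, R)
    | 6, one => none
    | 6, b => some (8, b, L)
    | 7, zero => some (5, one, L)
    | 7, one => some (7, one, R)
    | 7, b => some (7, b, R)
    | 8, zero => some (9, one, L)
    | 8, one => some (9, zero, R)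
    | 8, b => some (3, zero, L)
    | 9, zero => some (4, zero, R)
    | 9, one => some (9, zero, R)
    | 9, b => some (8, b, R)
  blank := zero
  start := 0

/-! ### The command table of the Civ:BE machine -/

/-- The tape symbols: what the head finds on a tile. -/
inductive TileSymbol
  | noImprovement
  | road
  | pillagedRoad
  deriving DecidableEq

/-- `TileSymbol` as a three-element type. -/
def TileSymbol.equivFin : TileSymbol ≃ Fin 3 where
  toFun
    | .noImprovement => 0
    | .road => 1
    | .pillagedRoad => 2
  invFun
    | 0 => .noImprovement
    | 1 => .road
    | 2 => .pillagedRoad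
  left_inv := by rintro (_ | _ | _) <;> rfl
  right_inv := by decide

instance : Primcodable TileSymbol := Primcodable.ofEquiv (Fin 3) TileSymbol.equivFin

/-- The correspondence of the tape symbols with those of Rogozhin's machine. -/
def TileSymbol.equivRSymbol : TileSymbol ≃ RSymbol where
  toFun
    | .noImprovement => .zero
    | .road => .one
    | .pillagedRoad => .b
  invFun
    | .zero => .noImprovement
    | .one => .road
    | .b => .pillagedRoad
  left_inv := by rintro (_ | _ | _) <;> rfl
  right_inv := by rintro (_ | _ | _) <;> rfl

/-- Commands to the tape Worker and the Rover, before they move. -/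
inductive TapeCommand
  | leave
  | buildRoad
  | buildRoadAndPillage
  | pillageRoad
  | repairRoad
  | removeImprovement

/-- Commands to the state Worker. -/
inductive StateCommand
  | noBuild
  | build (n : ℕ)
  | remove (n : ℕ)

/-- An entry of the command table. -/
structure Command where
  tape : TapeCommand
  dir : Dir
  state : StateCommand

/-- The symbol on the tile under the head after the command. -/
def TapeCommand.write : TapeCommand → TileSymbol → TileSymbol
  | .leave, a => a
  | .buildRoad, _ => .road
  | .buildRoadAndPillage, _ => .pillagedRoad
  | .pillageRoad, _ => .pillagedRoad
  | .repairRoad, _ => .road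
  | .removeImprovement, _ => .noImprovement

/-- The number of Terrascapes after the command. -/
def StateCommand.apply : StateCommand → Fin 10 → Fin 10
  | .noBuild, q => q
  | .build n, q => Fin.ofNat 10 (q.val + n)
  | .remove n, q => Fin.ofNat 10 (q.val - n)

open Dir TileSymbol TapeCommand StateCommand in
/-- The command table; `none` is HALT. -/
def table : Fin 10 → TileSymbol → Option Command
  | 0, noImprovement => some ⟨buildRoad, R, noBuild⟩
  | 0, road => some ⟨removeImprovement, L, build 1⟩
  | 0, pillagedRoad => some ⟨leave, R, build 3⟩
  | 1, noImprovement => some ⟨leave, L, build 1⟩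
  | 1, road => some ⟨removeImprovement, L, noBuild⟩
  | 1, pillagedRoad => some ⟨leave, L, noBuild⟩
  | 2, noImprovement => some ⟨leave, L, remove 1⟩
  | 2, road => some ⟨pillageRoad, L, build 3⟩
  | 2, pillagedRoad => some ⟨leave, R, remove 2⟩
  | 3, noImprovement => some ⟨buildRoad, R, remove 3⟩
  | 3, road => some ⟨leave, R, build 1⟩
  | 3, pillagedRoad => some ⟨repairRoad, L, noBuild⟩
  | 4, noImprovement => some ⟨buildRoadAndPillage, L, remove 2⟩
  | 4, road => some ⟨leave, R, noBuild⟩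
  | 4, pillagedRoad => some ⟨leave, R, noBuild⟩
  | 5, noImprovement => some ⟨buildRoad, L, build 1⟩
  | 5, road => some ⟨leave, L, noBuild⟩
  | 5, pillagedRoad => some ⟨leave, L, noBuild⟩
  | 6, noImprovement => some ⟨leave, R, build 1⟩
  | 6, road => none
  | 6, pillagedRoad => some ⟨leave, L, build 2⟩
  | 7, noImprovement => some ⟨buildRoad, L, remove 2⟩
  | 7, road => some ⟨leave, R, noBuild⟩
  | 7, pillagedRoad => some ⟨leave, R, noBuild⟩
  | 8, noImprovement => some ⟨buildRoad, L, build 1⟩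
  | 8, road => some ⟨removeImprovement, R, build 1⟩
  | 8, pillagedRoad => some ⟨removeImprovement, L, remove 5⟩
  | 9, noImprovement => some ⟨leave, R, remove 5⟩
  | 9, road => some ⟨removeImprovement, R, noBuild⟩
  | 9, pillagedRoad => some ⟨leave, R, remove 1⟩

/-- The Turing machine with states `0, …, 9` and symbols No Improvement, Road, Pillaged Road whose
transition function is given by the command table. -/
def civMachine : TuringMachine (Fin 10) TileSymbol where
  δ q a := (table q a).map fun k => (k.state.apply q, k.tape.write a, k.dir)
  blank := .noImprovement
  start := 0

/-! ### The game -/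

/-- Tiles of the infinite hexagonal map, in axial coordinates. -/
abbrev Tile := ℤ × ℤ

/-- Two hexes are adjacent. -/
def Adjacent (s t : Tile) : Prop :=
  (t.1 - s.1, t.2 - s.2) ∈
    ({(1, 0), (-1, 0), (0, 1), (0, -1), (1, -1), (-1, 1)} : Set (ℤ × ℤ))

/-- Geographical types. -/
inductive Terrain
  | desert
  | grassland
  | plains
  | tundra
  | snow
  | water
  deriving DecidableEq

/-- What stands on a tile. -/
inductive Improvement
  | none
  | road
  | pillagedRoad
  | terrascape
  deriving DecidableEq

/-- What Workers can build. -/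
inductive Build
  | road
  | terrascape
  deriving DecidableEq

/-- The finished improvement. -/
def Build.result : Build → Improvement
  | .road => .road
  | .terrascape => .terrascape

/-- The improvement that stands for a tape symbol. -/
def TileSymbol.improvement : TileSymbol → Improvement
  | .noImprovement => .none
  | .road => .road
  | .pillagedRoad => .pillagedRoad

/-- The data of a game session that do not change while the machine runs. -/
structure World where
  /-- geography -/
  terrain : Tile → Terrain
  /-- the flat tiles that units can enter -/
  traversable : Set Tile
  /-- the tiles owned by the player -/
  owned : Set Tile
  /-- the tiles worked by Citizens -/
  worked : Finset Tile
  /-- the section of the map reserved for the states -/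
  stateSection : Finset Tile
  /-- the strip of the map used as the tape -/
  strip : ℤ → Tile
  /-- turns needed to build a Road -/
  roadTurns : ℕ
  /-- turns needed to build a Terrascape -/
  terrascapeTurns : ℕ
  /-- the number of Terrascapes that the player can maintain -/
  maintainable : ℕ
  /-- the player has the technology that allows Terrascapes -/
  terraforming : Bool
  /-- the player has the civic that gives 1 Culture more for every Terrascape -/
  ecoscaping : Bool
  /-- Culture yield of a Terrascape without that civic, by terrain -/
  terrascapeCulture : Terrain → ℕ
  /-- base Culture yield per turn -/
  baseCulture : ℕ

/-- The part of the game that Workers change. `progress t k` is the number of turns of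
work already done on the unfinished `k` on tile `t`. -/
structure Board where
  improvement : Tile → Improvement
  progress : Tile → Build → ℕ

/-- A game state: the board and the positions of the two Workers and the Rover. -/
structure GameState where
  board : Board
  stateWorker : Tile
  tapeWorker : Tile
  rover : Tile

/-- What a Worker can do in a turn, after moving. -/
inductive Job
  | idle
  | build (k : Build)
  | repair
  | remove
  deriving DecidableEq

/-- The orders of the player in a turn (apart from the moves). -/
structure Orders where
  stateWorker : Job
  tapeWorker : Job
  pillage : Bool

/-- Some unit works in the turn (otherwise the units only move). -/
def Orders.isWork (o : Orders) : Bool :=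
  o.stateWorker ≠ .idle || o.tapeWorker ≠ .idle || o.pillage

namespace World

/-- Number of turns that it takes to build `k`. -/
def turns (W : World) : Build → ℕ
  | .road => W.roadTurns
  | .terrascape => W.terrascapeTurns

/-- Culture yield of a worked Terrascape on the given terrain. -/
def terrascapeYield (W : World) (x : Terrain) : ℕ :=
  W.terrascapeCulture x + if W.ecoscaping then 1 else 0

/-- The Culture yield of the player in the turn: base yield and worked Terrascapes. -/
def culture (W : World) (s : GameState) : ℕ :=
  W.baseCulture + ∑ t ∈ W.worked,
    if s.board.improvement t = .terrascape then W.terrascapeYield (W.terrain t) else 0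

/-- The normalized Culture yield: difference from the base yield, in units of the yield of
one Terrascape on desert. -/
def normalizedCulture (W : World) (s : GameState) : ℚ :=
  ((W.culture s : ℚ) - W.baseCulture) / W.terrascapeYield .desert

/-- A unit can get from `t` to `t'` in a turn: it stays or moves to an adjacent tile. -/
def CanMove (W : World) (t t' : Tile) : Prop :=
  t' = t ∨ (Adjacent t t' ∧ t' ∈ W.traversable)

/-- A Worker on tile `t` is able to build: Roads on every tile without improvement, Terrascapes
only on the player's own tiles, with the technology, and if one more can be maintained. -/
def CanBuild (W : World) (B : Board) (t : Tile) : Build → Prop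
  | .road => B.improvement t = .none
  | .terrascape => B.improvement t = .none ∧ t ∈ W.owned ∧ W.terraforming = true ∧
      {u | B.improvement u = .terrascape}.encard < W.maintainable

end World

/-- Put an improvement on a tile, or clear it. -/
def Board.set (B : Board) (t : Tile) (i : Improvement) : Board :=
  { B with improvement := Function.update B.improvement t i }

/-- Set the progress of a building project on a tile. -/
def Board.setProgress (B : Board) (t : Tile) (k : Build) (n : ℕ) : Board :=
  { B with progress := Function.update B.progress t (Function.update (B.progress t) k n) }

/-- `Works W t j B B'`: one turn of job `j` by a Worker on tile `t` turns board `B` into `B'`.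
Building takes `W.turns k` turns, repairing and removing take one turn. -/
inductive Works (W : World) (t : Tile) : Job → Board → Board → Prop
  | idle (B : Board) : Works W t .idle B B
  | goOn (B : Board) (k : Build) :
      W.CanBuild B t k → B.progress t k + 1 < W.turns k →
      Works W t (.build k) B (B.setProgress t k (B.progress t k + 1))
  | finish (B : Board) (k : Build) :
      W.CanBuild B t k → W.turns k ≤ B.progress t k + 1 →
      Works W t (.build k) B ((B.setProgress t k 0).set t k.result)
  | repair (B : Board) :
      B.improvement t = .pillagedRoad → Works W t .repair B (B.set t .road)
  | remove (B : Board) :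
      B.improvement t ≠ .none → Works W t .remove B (B.set t .none)

/-- The Rover on tile `t` pillages the Road there, or does nothing. -/
inductive Pillages (t : Tile) : Bool → Board → Board → Prop
  | idle (B : Board) : Pillages t false B B
  | pillage (B : Board) :
      B.improvement t = .road → Pillages t true B (B.set t .pillagedRoad)

/-- One turn: all units move (the two Workers must not end on the same tile), then the Rover may
pillage, then the Workers do one turn of work. There is no other player, so nothing else
changes; and there is no limit on the number of turns. -/
def Turn (W : World) (s : GameState) (o : Orders) (s' : GameState) : Prop :=
  W.CanMove s.stateWorker s'.stateWorker ∧
  W.CanMove s.tapeWorker s'.tapeWorker ∧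
  W.CanMove s.rover s'.rover ∧
  s'.stateWorker ≠ s'.tapeWorker ∧
  ∃ B₁ B₂, Pillages s'.rover o.pillage s.board B₁ ∧
    Works W s'.tapeWorker o.tapeWorker B₁ B₂ ∧
    Works W s'.stateWorker o.stateWorker B₂ s'.board

/-- `Play W s os s'`: the orders `os`, one entry per turn, can lead from `s` to `s'`. -/
inductive Play (W : World) : GameState → List Orders → GameState → Prop
  | nil (s : GameState) : Play W s [] s
  | cons {s s₁ s' : GameState} {o : Orders} {os : List Orders} :
      Turn W s o s₁ → Play W s₁ os s' → Play W s (o :: os) s'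

/-- The standing assumptions on the session. -/
structure World.Suitable (W : World) : Prop where
  /-- the tape is a continuous strip, infinite in both directions, of flat traversable tiles -/
  strip_injective : Function.Injective W.strip
  strip_adjacent : ∀ i, Adjacent (W.strip i) (W.strip (i + 1))
  strip_traversable : ∀ i, W.strip i ∈ W.traversable
  /-- the state section is disjoint from it, connected, and consists of flat desert tiles owned
  by the player -/
  section_disjoint : ∀ i, W.strip i ∉ W.stateSection
  section_connected : ∀ s ∈ W.stateSection, ∀ t ∈ W.stateSection,
    Relation.ReflTransGen (fun u v => Adjacent u v ∧ v ∈ W.stateSection) s t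
  section_desert : ∀ t ∈ W.stateSection, W.terrain t = .desert
  section_traversable : ∀ t ∈ W.stateSection, t ∈ W.traversable
  section_owned : ∀ t ∈ W.stateSection, t ∈ W.owned
  /-- at least nine tiles of the section are worked -/
  nine_worked : 9 ≤ (W.stateSection ∩ W.worked).card
  /-- at least nine Terrascapes can be built and maintained -/
  nine_maintainable : 9 ≤ W.maintainable
  has_terraforming : W.terraforming = true
  has_ecoscaping : W.ecoscaping = true
  roadTurns_pos : 1 ≤ W.roadTurns
  terrascapeTurns_pos : 1 ≤ W.terrascapeTurns

/-- The game state `s` represents the configuration `c`: the internal state is the normalized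
Culture yield, the tape is the strip, and the tape Worker and the Rover are the head. The state
Worker is in the state section; Terrascapes stand only on its worked tiles, and
these tiles carry nothing else. -/
structure Represents (W : World) (s : GameState) (c : Cfg (Fin 10) TileSymbol) : Prop where
  state_eq : W.normalizedCulture s = (c.state.val : ℚ)
  tape_eq : ∀ i, s.board.improvement (W.strip i) = (c.tape i).improvement
  tapeWorker_eq : s.tapeWorker = W.strip c.head
  rover_eq : s.rover = W.strip c.head
  stateWorker_mem : s.stateWorker ∈ W.stateSection
  terrascape_mem : ∀ t, s.board.improvement t = .terrascape → t ∈ W.stateSection ∩ W.worked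
  stateTile : ∀ t ∈ W.stateSection ∩ W.worked,
    s.board.improvement t = .none ∨ s.board.improvement t = .terrascape

/-- The jobs that a tape command asks for, of the tape Worker and of the Rover. -/
def TapeCommand.Permits : TapeCommand → Job → Bool → Prop
  | .leave, j, p => j = .idle ∧ p = false
  | .buildRoad, j, p => (j = .idle ∨ j = .build .road) ∧ p = false
  | .buildRoadAndPillage, j, _ => j = .idle ∨ j = .build .road
  | .pillageRoad, j, _ => j = .idle
  | .repairRoad, j, p => (j = .idle ∨ j = .repair) ∧ p = false
  | .removeImprovement, j, p => (j = .idle ∨ j = .remove) ∧ p = false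

/-- The jobs that a state command asks for, of the state Worker. -/
def StateCommand.Permits : StateCommand → Job → Prop
  | .noBuild, j => j = .idle
  | .build _, j => j = .idle ∨ j = .build .terrascape
  | .remove _, j => j = .idle ∨ j = .remove

/-- In the turn, the units do nothing but what the command asks for (or only move). -/
def Command.Permits (k : Command) (o : Orders) : Prop :=
  k.tape.Permits o.tapeWorker o.pillage ∧ k.state.Permits o.stateWorker

end CivBE

/-! Universality is proved by a chain of simulations. The halting configuration of a program on an
input, coded as a number, is a partial recursive function (`Program.partrec_haltingCfg`). Such a
function is compiled to a Turing machine with two symbols, and the two halves of its tape are read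
as binary numbers. The result is a `PairMachine`, which pops the last bit of its second number and
then acts on both numbers by affine maps (`exists_pairMachine_of_partrec`). One of its steps takes
up to three passes of a 2-tag system over a word that holds the numbers in unary
(`PairMachine.word_step`). Since a tag system reads every other letter, the popped bit appears as a
phase: it decides which component of each later pair of letters is read.

The tag system runs on the ten-state machine as follows (`tagGap_step`). To the left of the head
lies a library of productions, to the right the current word as a queue. A letter is a unary number:
the number of chunks of the library between the head and its production. Each mark that is read
moves the border of the passed part one chunk to the left, so the marks of a letter lead to its
production (`find_production`). States 1 and 2 recognise the end of a chunk by the parity of a block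
of empty tiles. The production is then copied, tile by tile, to the far end of the queue
(`write_block`, `write_prodTail`). A last sweep to the right restores the library and erases the
second letter. The halting letter has no production; its marks lead beyond the library to a Road on
which state 6 halts (`tagGap_halt`).

The result can be read off because the length of the final word is affine in the numbers, and it is
the number of double pillaged Roads on the final tape (`PairMachine.sepCount_of_halts`). Value and
argument have the same coding, with a primitive recursive left inverse, so both `enc` and `dec` are
primitive recursive.

For the game, all Terrascapes stand on worked desert tiles, so the normalized Culture yield is their
number (`normalizedCulture_eq`). `Holds` records that number, and each command is carried out by
elementary plays between states satisfying it. The bound on the turns is uniform because the state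
section is finite (`exists_walkBound`); the bound on work is a finite check of the table
(`table_cost`). -/

namespace CivBE

open StateTransition TileSymbol

/-! ### Tapes as pairs of lists -/

local notation "𝟎" => TileSymbol.noImprovement
local notation "𝟏" => TileSymbol.road
local notation "𝐛" => TileSymbol.pillagedRoad

/-- A configuration of a machine as a pair of lists: `l` is the tape left of a gap between two
cells, read leftwards, `r` the tape right of it, and the head is on the cell next to the gap
on the side `dir`. -/
structure Gap where
  dir : Dir
  state : Fin 10
  l : List TileSymbol
  r : List TileSymbol

/-- One step of the machine on a tape given by two lists. -/
def Gap.step : Gap → Option Gap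
  | ⟨.R, q, l, r⟩ => (civMachine.δ q (r.headD 𝟎)).map fun
      | (q', a, .R) => ⟨.R, q', a :: l, r.tail⟩
      | (q', a, .L) => ⟨.L, q', l, a :: r.tail⟩
  | ⟨.L, q, l, r⟩ => (civMachine.δ q (l.headD 𝟎)).map fun
      | (q', a, .R) => ⟨.R, q', a :: l.tail, r⟩
      | (q', a, .L) => ⟨.L, q', l.tail, a :: r⟩

/-- The two-way infinite tape with the gap left of cell `p`. -/
def gapTape (p : ℤ) (l r : List TileSymbol) (i : ℤ) : TileSymbol :=
  if p ≤ i then r.getD (i - p).toNat 𝟎 else l.getD (p - 1 - i).toNat 𝟎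

/-- The configuration of the machine with the gap left of cell `p`. -/
def Gap.toCfg (p : ℤ) (g : Gap) : Cfg (Fin 10) TileSymbol where
  state := g.state
  head := match g.dir with
    | .R => p
    | .L => p - 1
  tape := gapTape p g.l g.r

theorem gapTape_self (p : ℤ) (l r : List TileSymbol) : gapTape p l r p = r.headD 𝟎 := by
  cases r <;> simp [gapTape]

theorem gapTape_pred (p : ℤ) (l r : List TileSymbol) : gapTape p l r (p - 1) = l.headD 𝟎 := by
  cases l <;> simp [gapTape]

theorem getD_cons_of_pos (a : TileSymbol) (l : List TileSymbol) {n : ℕ} (h : 0 < n) :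
    (a :: l).getD n 𝟎 = l.getD (n - 1) 𝟎 := by
  obtain ⟨m, rfl⟩ := Nat.exists_eq_succ_of_ne_zero h.ne'
  simp

theorem getD_tail (l : List TileSymbol) (n : ℕ) : l.tail.getD n 𝟎 = l.getD (n + 1) 𝟎 := by
  cases l <;> simp

theorem gapTape_update_right (p : ℤ) (l r : List TileSymbol) (a : TileSymbol) :
    Function.update (gapTape p l r) p a = gapTape p l (a :: r.tail) := by
  ext i
  rcases lt_trichotomy i p with h | rfl | h
  · simp [Function.update_of_ne h.ne, gapTape, not_le.mpr h]
  · simp [gapTape]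
  · rw [Function.update_of_ne h.ne', gapTape, gapTape, if_pos h.le, if_pos h.le,
      getD_cons_of_pos _ _ (by omega), getD_tail]
    congr 1; omega

theorem gapTape_update_left (p : ℤ) (l r : List TileSymbol) (a : TileSymbol) :
    Function.update (gapTape p l r) (p - 1) a = gapTape p (a :: l.tail) r := by
  ext i
  rcases lt_trichotomy i (p - 1) with h | rfl | h
  · have h' : ¬ p ≤ i := by omega
    rw [Function.update_of_ne h.ne, gapTape, gapTape, if_neg h', if_neg h',
      getD_cons_of_pos _ _ (by omega), getD_tail]
    congr 1; omega
  · simp [gapTape]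
  · have h' : p ≤ i := by omega
    rw [Function.update_of_ne h.ne', gapTape, gapTape, if_pos h', if_pos h']

theorem gapTape_shift (p : ℤ) (l r : List TileSymbol) (a : TileSymbol) :
    gapTape p l (a :: r) = gapTape (p + 1) (a :: l) r := by
  ext i
  rcases lt_trichotomy i p with h | rfl | h
  · rw [gapTape, gapTape, if_neg (by omega), if_neg (by omega),
      getD_cons_of_pos _ _ (by omega)]
    congr 1; omega
  · simp [gapTape]
  · rw [gapTape, gapTape, if_pos (by omega), if_pos (by omega),
      getD_cons_of_pos _ _ (by omega)]
    congr 1; omega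

/-- A `Gap` carries no absolute coordinate, hence the existential `p'`: the gap stays in place when
the head turns around and shifts by one cell otherwise. -/
theorem Gap.toCfg_step (p : ℤ) (g : Gap) :
    (g.step = none → civMachine.step (g.toCfg p) = none) ∧
      ∀ g', g.step = some g' → ∃ p', civMachine.step (g.toCfg p) = some (g'.toCfg p') := by
  obtain ⟨d, q, l, r⟩ := g
  cases d
  · cases h : civMachine.δ q (l.headD 𝟎) with
    | none =>
      simp [Gap.step, Gap.toCfg, TuringMachine.step, gapTape_pred, h, -List.headD_eq_head?_getD]
    | some x =>
      obtain ⟨q', a, d⟩ := x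
      cases d
      · simp only [Gap.step, h, Option.map_some, reduceCtorEq, false_implies, true_and,
          Option.some.injEq, forall_eq']
        refine ⟨p - 1, ?_⟩
        simp only [Gap.toCfg, TuringMachine.step, gapTape_pred, h, gapTape_update_left,
          Option.map_some, Dir.shift, Option.some.injEq, Cfg.mk.injEq, true_and]
        rw [gapTape_shift, sub_add_cancel]
      · simp only [Gap.step, h, Option.map_some, reduceCtorEq, false_implies, true_and,
          Option.some.injEq, forall_eq']
        refine ⟨p, ?_⟩
        simp [Gap.toCfg, TuringMachine.step, gapTape_pred, h, gapTape_update_left, Dir.shift,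
          -List.headD_eq_head?_getD]
  · cases h : civMachine.δ q (r.headD 𝟎) with
    | none =>
      simp [Gap.step, Gap.toCfg, TuringMachine.step, gapTape_self, h, -List.headD_eq_head?_getD]
    | some x =>
      obtain ⟨q', a, d⟩ := x
      cases d
      · simp only [Gap.step, h, Option.map_some, reduceCtorEq, false_implies, true_and,
          Option.some.injEq, forall_eq']
        refine ⟨p, ?_⟩
        simp [Gap.toCfg, TuringMachine.step, gapTape_self, h, gapTape_update_right, Dir.shift,
          -List.headD_eq_head?_getD]
      · simp only [Gap.step, h, Option.map_some, reduceCtorEq, false_implies, true_and,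
          Option.some.injEq, forall_eq']
        refine ⟨p + 1, ?_⟩
        simp [Gap.toCfg, TuringMachine.step, gapTape_self, h, gapTape_update_right, Dir.shift,
          gapTape_shift, -List.headD_eq_head?_getD]

theorem Gap.respects :
    Respects Gap.step civMachine.step fun g c => ∃ p, c = g.toCfg p := by
  rintro g _ ⟨p, rfl⟩
  obtain ⟨h₀, h₁⟩ := g.toCfg_step p
  cases h : g.step with
  | none => exact h₀ h
  | some g' =>
    obtain ⟨p', hp'⟩ := h₁ g' h
    exact ⟨_, ⟨p', rfl⟩, .single hp'⟩

theorem Gap.toCfg_init (l r : List TileSymbol) :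
    civMachine.init (l, r) = (Gap.mk .R 0 l r).toCfg 0 := by
  have h : (civMachine.init (l, r)).tape = gapTape 0 l r := by
    ext i
    have : 0 - 1 - i = -i - 1 := by omega
    simp only [gapTape, TuringMachine.init, civMachine, sub_zero, this]
  rw [Gap.toCfg, ← h]
  rfl

end CivBE

namespace CivBE

open StateTransition TileSymbol

local notation "𝟎" => TileSymbol.noImprovement
local notation "𝟏" => TileSymbol.road
local notation "𝐛" => TileSymbol.pillagedRoad

/-! ### Sweeps of the head -/

/-- The effect of a leftward sweep in state `1`: Roads are removed. -/
def clear : TileSymbol → TileSymbol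
  | 𝟏 => 𝟎
  | a => a

/-- The effect of a rightward sweep in state `0`: Roads are built. -/
def fill : TileSymbol → TileSymbol
  | 𝟎 => 𝟏
  | a => a

theorem replicate_append_cons {α : Type*} (n : ℕ) (a : α) (l : List α) :
    List.replicate n a ++ a :: l = List.replicate (n + 1) a ++ l := by
  rw [List.replicate_succ', List.append_assoc, List.singleton_append]

theorem Gap.reaches_of_step {g g' g'' : Gap} (h : g.step = some g')
    (hg : Reaches Gap.step g' g'') : Reaches Gap.step g g'' :=
  .head h hg

/-- Passed parts of the tape, read leftwards: each pillaged Road is preceded by a Road. -/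
inductive Passable : List TileSymbol → Prop
  | nil : Passable []
  | one {m : List TileSymbol} : Passable m → Passable (𝟏 :: m)
  | mark {m : List TileSymbol} : Passable m → Passable (𝟏 :: 𝐛 :: m)

theorem Passable.append {m m' : List TileSymbol} (h : Passable m) (h' : Passable m') :
    Passable (m ++ m') := by
  induction h with
  | nil => exact h'
  | one _ ih => exact .one ih
  | mark _ ih => exact .mark ih

theorem Passable.replicate (n : ℕ) : Passable (List.replicate n 𝟏) := by
  induction n with
  | zero => exact .nil
  | succ n ih => exact .one ih

theorem Passable.replicate_mark (n : ℕ) : Passable (List.replicate (n + 1) 𝟏 ++ [𝐛]) := by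
  rw [List.replicate_succ', List.append_assoc]
  exact (Passable.replicate n).append (.mark .nil)

theorem Passable.ne_zero {m : List TileSymbol} (h : Passable m) : ∀ a ∈ m, a ≠ 𝟎 := by
  induction h with
  | nil => simp
  | one _ ih => simpa using ih
  | mark _ ih => simpa using ih

/-- State 1 is left only on an empty tile, and a passable part contains none. -/
theorem Passable.sweep_left {m : List TileSymbol} (h : Passable m) (l r : List TileSymbol) :
    Reaches Gap.step ⟨.L, 1, m ++ l, r⟩ ⟨.L, 1, l, (m.map clear).reverse ++ r⟩ := by
  induction h generalizing r with
  | nil => exact .refl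
  | one _ ih =>
    refine Gap.reaches_of_step rfl ?_
    simpa using! ih (𝟎 :: r)
  | mark _ ih =>
    refine Gap.reaches_of_step rfl (Gap.reaches_of_step rfl ?_)
    simpa using! ih (𝐛 :: 𝟎 :: r)

/-- Here the shape of `Passable` matters: a pillaged Road sends state 0 to state 3, which returns to
0 only on an empty tile. The cleared Road to its right is that tile. -/
theorem Passable.sweep_back {m : List TileSymbol} (h : Passable m) (l r : List TileSymbol) :
    Reaches Gap.step ⟨.R, 0, l, (m.map clear).reverse ++ r⟩ ⟨.R, 0, m ++ l, r⟩ := by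
  induction h generalizing r with
  | nil => exact .refl
  | one _ ih =>
    have := ih (𝟎 :: r)
    simp only [List.map_cons, List.reverse_cons, List.append_assoc]
    exact this.trans (Gap.reaches_of_step rfl .refl)
  | mark _ ih =>
    have := ih (𝐛 :: 𝟎 :: r)
    simp only [List.map_cons, List.reverse_cons, List.append_assoc]
    exact this.trans (Gap.reaches_of_step rfl (Gap.reaches_of_step rfl .refl))

/-- A pillaged Road sends state 9 to 8, and the Road to its right sends 8 back to 9. Two adjacent
pillaged Roads break this rhythm, which is how the sweep later recognises a separator. -/
theorem Passable.restore {m : List TileSymbol} (h : Passable m) (l r : List TileSymbol) :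
    Reaches Gap.step ⟨.R, 9, l, m.reverse ++ r⟩ ⟨.R, 9, m.map clear ++ l, r⟩ := by
  induction h generalizing r with
  | nil => exact .refl
  | one _ ih =>
    have := ih (𝟏 :: r)
    simp only [List.reverse_cons, List.append_assoc]
    exact this.trans (Gap.reaches_of_step rfl .refl)
  | mark _ ih =>
    have := ih (𝐛 :: 𝟏 :: r)
    simp only [List.reverse_cons, List.append_assoc]
    exact this.trans (Gap.reaches_of_step rfl (Gap.reaches_of_step rfl .refl))

theorem sweep_five {x : List TileSymbol} (h : ∀ a ∈ x, a ≠ 𝟎) (l r : List TileSymbol) :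
    Reaches Gap.step ⟨.L, 5, x ++ l, r⟩ ⟨.L, 5, l, x.reverse ++ r⟩ := by
  induction x generalizing r with
  | nil => exact .refl
  | cons a x ih =>
    simp only [List.mem_cons, forall_eq_or_imp] at h
    cases a
    · exact absurd rfl h.1
    · exact Gap.reaches_of_step rfl (by simpa using! ih h.2 (𝟏 :: r))
    · exact Gap.reaches_of_step rfl (by simpa using! ih h.2 (𝐛 :: r))

theorem sweep_four {x : List TileSymbol} (h : ∀ a ∈ x, a ≠ 𝟎) (l r : List TileSymbol) :
    Reaches Gap.step ⟨.R, 4, l, x ++ r⟩ ⟨.R, 4, x.reverse ++ l, r⟩ := by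
  induction x generalizing l with
  | nil => exact .refl
  | cons a x ih =>
    simp only [List.mem_cons, forall_eq_or_imp] at h
    cases a
    · exact absurd rfl h.1
    · exact Gap.reaches_of_step rfl (by simpa using! ih h.2 (𝟏 :: l))
    · exact Gap.reaches_of_step rfl (by simpa using! ih h.2 (𝐛 :: l))

theorem sweep_seven {x : List TileSymbol} (h : ∀ a ∈ x, a ≠ 𝟎) (l r : List TileSymbol) :
    Reaches Gap.step ⟨.R, 7, l, x ++ r⟩ ⟨.R, 7, x.reverse ++ l, r⟩ := by
  induction x generalizing l with
  | nil => exact .refl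
  | cons a x ih =>
    simp only [List.mem_cons, forall_eq_or_imp] at h
    cases a
    · exact absurd rfl h.1
    · exact Gap.reaches_of_step rfl (by simpa using! ih h.2 (𝟏 :: l))
    · exact Gap.reaches_of_step rfl (by simpa using! ih h.2 (𝐛 :: l))

theorem sweep_zeros (n : ℕ) (l r : List TileSymbol) :
    Reaches Gap.step ⟨.R, 0, l, List.replicate n 𝟎 ++ r⟩ ⟨.R, 0, List.replicate n 𝟏 ++ l, r⟩ := by
  induction n generalizing l with
  | zero => exact .refl
  | succ n ih =>
    have h := ih (𝟏 :: l)
    rw [replicate_append_cons] at h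
    exact Gap.reaches_of_step rfl h

/-- States 1 and 2 alternate on empty tiles and so remember the parity of a block. -/
theorem sweep_even (n : ℕ) (l r : List TileSymbol) :
    Reaches Gap.step ⟨.L, 1, List.replicate (2 * n) 𝟎 ++ l, r⟩
      ⟨.L, 1, l, List.replicate (2 * n) 𝟎 ++ r⟩ := by
  induction n generalizing r with
  | zero => exact .refl
  | succ n ih =>
    have h := ih (𝟎 :: 𝟎 :: r)
    rw [replicate_append_cons, replicate_append_cons] at h
    exact Gap.reaches_of_step rfl (Gap.reaches_of_step rfl h)

/-! ### Searching the production -/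

/-- A part of the tape that is passed when one Road of the data is read: blocks of empty tiles of
even length and a last one of odd length, each ended by a pillaged Road. -/
inductive Chunk : List TileSymbol → Prop
  | last (n : ℕ) : Chunk (List.replicate (2 * n + 1) 𝟎 ++ [𝐛])
  | cons (n : ℕ) {c : List TileSymbol} :
      Chunk c → Chunk (List.replicate (2 * n + 2) 𝟎 ++ 𝐛 :: c)

theorem Chunk.passable {c : List TileSymbol} (h : Chunk c) : Passable (c.map fill) := by
  induction h with
  | last n => simpa [fill] using Passable.replicate_mark (2 * n)
  | cons n _ ih => simpa [fill] using (Passable.replicate_mark (2 * n + 1)).append ih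

theorem Chunk.clear_fill {c : List TileSymbol} (h : Chunk c) :
    (c.map fill).map clear = c := by
  induction h with
  | last n => simp [fill, clear]
  | cons n _ ih => simpa [fill, clear] using ih

/-- After an even block the head meets the pillaged Road in state 1 and goes on; after an odd block
it meets it in state 2 and turns back, filling the empty tiles on its way. -/
theorem Chunk.search {c : List TileSymbol} (h : Chunk c) (l r : List TileSymbol) :
    Reaches Gap.step ⟨.L, 1, c ++ l, r⟩ ⟨.R, 0, c.map fill ++ l, r⟩ := by
  induction h generalizing r with
  | last n =>
    have h₁ := sweep_even n (𝟎 :: 𝐛 :: l) r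
    have h₂ : Reaches Gap.step ⟨.R, 0, 𝐛 :: l, 𝟎 :: (List.replicate (2 * n) 𝟎 ++ r)⟩ _ :=
      sweep_zeros (2 * n + 1) (𝐛 :: l) r
    rw [replicate_append_cons] at h₁
    simp only [fill, List.append_assoc, List.singleton_append, List.map_append,
      List.map_replicate, List.map_cons, List.map_nil]
    exact h₁.trans (Gap.reaches_of_step rfl (Gap.reaches_of_step rfl h₂))
  | @cons n c _ ih =>
    have h₁ := sweep_even (n + 1) (𝐛 :: c ++ l) r
    have h₂ := ih (𝐛 :: 𝟎 :: List.replicate (2 * n + 1) 𝟎 ++ r)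
    have h₃ := sweep_zeros (2 * n + 1) (𝟏 :: 𝐛 :: c.map fill ++ l) r
    rw [List.cons_append, List.cons_append, replicate_append_cons] at h₃
    simp only [fill, List.append_assoc, List.cons_append, List.map_append,
      List.map_replicate, List.map_cons]
    exact h₁.trans (Gap.reaches_of_step rfl (h₂.trans
      (Gap.reaches_of_step rfl (Gap.reaches_of_step rfl h₃))))

/-- The mark is first removed and then rebuilt by the returning head, so it joins the passed part,
and so does one more chunk of the library. -/
theorem Chunk.read_mark {m c : List TileSymbol} (hm : Passable m) (hc : Chunk c)
    (l r : List TileSymbol) :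
    Reaches Gap.step ⟨.R, 0, m ++ (c ++ l), 𝟏 :: r⟩ ⟨.R, 0, 𝟏 :: m ++ (c.map fill ++ l), r⟩ := by
  refine Gap.reaches_of_step rfl ((hm.sweep_left _ _).trans ((hc.search _ _).trans
    ((hm.sweep_back _ _).trans (Gap.reaches_of_step rfl .refl))))

/-- The passed part stays passable after each mark, so reading can be iterated: marks are matched
with chunks one by one. -/
theorem read_marks {cs : List (List TileSymbol)} (hcs : ∀ c ∈ cs, Chunk c)
    {m : List TileSymbol} (hm : Passable m) (l r : List TileSymbol) :
    Reaches Gap.step ⟨.R, 0, m ++ (cs.flatten ++ l), List.replicate cs.length 𝟏 ++ r⟩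
      ⟨.R, 0, List.replicate cs.length 𝟏 ++ (m ++ (cs.flatten.map fill ++ l)), r⟩ := by
  induction cs generalizing m with
  | nil => exact .refl
  | cons c cs ih =>
    simp only [List.mem_cons, forall_eq_or_imp] at hcs
    have h₁ := Chunk.read_mark hm hcs.1 (cs.flatten ++ l) (List.replicate cs.length 𝟏 ++ r)
    have h₂ := ih hcs.2 (.append (.one hm) hcs.1.passable)
    simp only [List.append_assoc] at h₂
    simp only [List.flatten_cons, List.append_assoc, List.length_cons, List.map_append]
    refine h₁.trans (h₂.trans ?_)
    rw [List.replicate_succ', List.append_assoc]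
    exact .refl

/-! ### Writing the production -/

/-- State 5 fills one empty tile, state 6 checks that another follows, and state 7 runs to the first
blank, which lies behind `x` by `hx`, and builds a Road there. The last tile has no empty successor
and is not copied. -/
theorem write_marks (n : ℕ) (l : List TileSymbol) {x : List TileSymbol} (hx : ∀ a ∈ x, a ≠ 𝟎) :
    Reaches Gap.step ⟨.L, 5, List.replicate (n + 1) 𝟎 ++ l, x⟩
      ⟨.L, 5, 𝟎 :: l, List.replicate n 𝟏 ++ x ++ List.replicate n 𝟏⟩ := by
  induction n generalizing x with
  | zero => simpa using! Relation.ReflTransGen.refl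
  | succ n ih =>
    have hx₁ : ∀ a ∈ 𝟏 :: x, a ≠ 𝟎 := by simpa using hx
    have hx₂ : ∀ a ∈ 𝟏 :: x ++ [𝟏], a ≠ 𝟎 := by
      simpa [or_imp, forall_and] using hx
    have h₁ := sweep_seven hx₁ (List.replicate (n + 1) 𝟎 ++ l) []
    have h₂ := sweep_five (x := (𝟏 :: x).reverse) (by simpa [or_imp, forall_and] using hx)
      (List.replicate (n + 1) 𝟎 ++ l) [𝟏]
    have h₃ := ih hx₂
    rw [List.append_nil] at h₁
    rw [List.reverse_reverse] at h₂
    have e : List.replicate n 𝟏 ++ (𝟏 :: x ++ [𝟏]) ++ List.replicate n 𝟏 =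
        List.replicate (n + 1) 𝟏 ++ x ++ List.replicate (n + 1) 𝟏 := by
      simp only [List.cons_append, List.append_assoc, replicate_append_cons]
      rfl
    rw [← e]
    exact Gap.reaches_of_step rfl (Gap.reaches_of_step rfl (h₁.trans
      (Gap.reaches_of_step rfl (h₂.trans h₃))))

end CivBE

/-! ### Writing blocks, separators and letters; codes of words and productions -/

namespace CivBE

open StateTransition TileSymbol

local notation "𝟎" => TileSymbol.noImprovement
local notation "𝟏" => TileSymbol.road
local notation "𝐛" => TileSymbol.pillagedRoad

/-- The remaining empty tile is filled, and state 6 then finds the pillaged Road instead of an empty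
tile. So a block needs one tile more than it writes marks. -/
theorem write_block (n : ℕ) (l : List TileSymbol) {x : List TileSymbol} (hx : ∀ a ∈ x, a ≠ 𝟎) :
    Reaches Gap.step ⟨.L, 5, List.replicate (n + 1) 𝟎 ++ 𝐛 :: l, x⟩
      ⟨.L, 8, l, 𝐛 :: List.replicate (n + 1) 𝟏 ++ x ++ List.replicate n 𝟏⟩ :=
  (write_marks n (𝐛 :: l) hx).trans (Gap.reaches_of_step rfl (Gap.reaches_of_step rfl .refl))

/-- State 4 puts one pillaged Road on the first blank and state 2 pillages the Road before it. A
separator thus costs the preceding letter its last mark, whence `marks idx a - 1` in `body`. -/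
theorem write_separator (l : List TileSymbol) {x : List TileSymbol} (hx : ∀ a ∈ x, a ≠ 𝟎) :
    Reaches Gap.step ⟨.R, 4, l, x ++ [𝟏]⟩ ⟨.L, 5, l, x ++ [𝐛, 𝐛]⟩ := by
  have h₁ := sweep_four (x := x ++ [𝟏]) (by simpa [or_imp, forall_and] using hx) l []
  have h₂ := sweep_five (x := x.reverse) (by simpa using hx) l [𝐛, 𝐛]
  rw [List.append_nil, List.reverse_append] at h₁
  rw [List.reverse_reverse] at h₂
  exact h₁.trans (Gap.reaches_of_step rfl (Gap.reaches_of_step rfl h₂))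

theorem write_separator_left (l : List TileSymbol) {x : List TileSymbol} (hx : ∀ a ∈ x, a ≠ 𝟎) :
    Reaches Gap.step ⟨.L, 8, 𝟎 :: 𝟎 :: l, x ++ [𝟏]⟩ ⟨.L, 5, 𝟎 :: l, 𝟏 :: x ++ [𝐛, 𝐛]⟩ :=
  Gap.reaches_of_step rfl (Gap.reaches_of_step rfl
    (write_separator (x := 𝟏 :: x) (𝟎 :: l) (by simpa using hx)))

/-- Of the `n + 2` empty tiles, one triggers the separator and one is the uncopied last tile of the
block. -/
theorem write_letter (n : ℕ) (l : List TileSymbol) {x : List TileSymbol}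
    (hx : ∀ a ∈ x, a ≠ 𝟎) :
    Reaches Gap.step ⟨.L, 8, List.replicate (n + 2) 𝟎 ++ 𝐛 :: l, x ++ [𝟏]⟩
      ⟨.L, 8, l, 𝐛 :: List.replicate (n + 2) 𝟏 ++ x ++ [𝐛, 𝐛] ++ List.replicate n 𝟏⟩ := by
  have h := write_block n l (x := 𝟏 :: x ++ [𝐛, 𝐛])
    (by simpa [or_imp, forall_and] using hx)
  simp only [List.cons_append, List.append_assoc, replicate_append_cons] at h ⊢
  have hsep := write_separator_left (List.replicate n 𝟎 ++ 𝐛 :: l) hx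
  exact hsep.trans h

/-! ### Codes of words of a tag system -/

section Tag

variable {A : Type} (idx : A → ℕ) (prod : A → List A)

/-- The number of marks for which a letter stands. -/
def marks (a : A) : ℕ := 2 * idx a + 2

/-- The code of a word, in which every letter is followed by a separator. -/
def body (w : List A) : List TileSymbol :=
  w.flatMap fun a => List.replicate (marks idx a - 1) 𝟏 ++ [𝐛, 𝐛]

/-- The code of a nonempty word on the tape: the last separator is still missing, and the last
letter is complete. -/
def data (w : List A) : List TileSymbol :=
  (body idx w).dropLast.dropLast ++ [𝟏]

theorem body_ne_zero (w : List A) : ∀ a ∈ body idx w, a ≠ 𝟎 := by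
  intro a ha
  simp only [body, List.mem_flatMap, List.mem_append, List.mem_replicate, List.mem_cons] at ha
  rintro rfl
  simp at ha

theorem body_append (v w : List A) : body idx (v ++ w) = body idx v ++ body idx w := by
  simp [body]

theorem body_cons (a : A) (w : List A) :
    body idx (a :: w) = List.replicate (marks idx a - 1) 𝟏 ++ 𝐛 :: 𝐛 :: body idx w := by
  simp [body]

theorem exists_body_eq {w : List A} (hw : w ≠ []) : ∃ x, body idx w = x ++ [𝐛, 𝐛] := by
  rcases List.eq_nil_or_concat w with rfl | ⟨w, a, rfl⟩
  · exact absurd rfl hw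
  · exact ⟨body idx w ++ List.replicate (marks idx a - 1) 𝟏, by simp [body]⟩

theorem data_eq {w : List A} {x : List TileSymbol} (h : body idx w = x ++ [𝐛, 𝐛]) :
    data idx w = x ++ [𝟏] := by
  simp [data, h, List.dropLast_append_of_ne_nil]

/-- The code of the letters of a production after the first, read leftwards. -/
def prodTail (v : List A) : List TileSymbol :=
  v.flatMap fun a => List.replicate (marks idx a + 2) 𝟎 ++ [𝐛]

/-- The code of a production, read leftwards. -/
def prodCode : List A → List TileSymbol
  | [] => []
  | c :: v => List.replicate (marks idx c + 1) 𝟎 ++ 𝐛 :: (prodTail idx v ++ [𝟎, 𝐛])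

theorem prodTail_cons (a : A) (v : List A) :
    prodTail idx (a :: v) = List.replicate (marks idx a + 2) 𝟎 ++ 𝐛 :: prodTail idx v := by
  simp [prodTail]

/-- The blocks of `marks idx a + 2` tiles are even, so only the closing single tile ends the chunk.
-/
theorem chunk_prodTail (v : List A) : Chunk (prodTail idx v ++ [𝟎, 𝐛]) := by
  induction v with
  | nil => exact Chunk.last 0
  | cons a v ih =>
    have := Chunk.cons (idx a + 1) ih
    simpa [prodTail_cons, marks, mul_add] using this

/-- The odd length makes the first letter a chunk of its own. Hence a nonempty production counts as
two chunks whatever its length. -/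
theorem chunk_first (c : A) : Chunk (List.replicate (marks idx c + 1) 𝟎 ++ [𝐛]) :=
  Chunk.last (idx c + 1)

/-- The code of a production as two chunks. -/
def prodChunks : List A → List (List TileSymbol)
  | [] => []
  | c :: v => [List.replicate (marks idx c + 1) 𝟎 ++ [𝐛], prodTail idx v ++ [𝟎, 𝐛]]

theorem prodChunks_flatten (w : List A) : (prodChunks idx w).flatten = prodCode idx w := by
  cases w <;> simp [prodChunks, prodCode]

theorem chunk_of_mem_prodChunks {w : List A} {c : List TileSymbol} (h : c ∈ prodChunks idx w) :
    Chunk c := by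
  cases w with
  | nil => simp [prodChunks] at h
  | cons a v =>
    simp only [prodChunks, List.mem_cons, List.not_mem_nil, or_false] at h
    rcases h with rfl | rfl
    · exact chunk_first idx a
    · exact chunk_prodTail idx v

theorem prodTail_passable (v : List A) : Passable ((prodTail idx v).map fill) := by
  induction v with
  | nil => exact .nil
  | cons a v ih =>
    simpa [prodTail_cons, fill] using (Passable.replicate_mark (marks idx a + 1)).append ih

theorem prodTail_clear_fill (v : List A) :
    ((prodTail idx v).map fill).map clear = prodTail idx v := by
  induction v with
  | nil => rfl
  | cons a v ih => simpa [prodTail_cons, fill, clear] using ih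

/-- Between two letters the queue ends in a Road where its last separator will begin, so `x` is the
code of `u` without that separator. `y` is the tape between the unread production and the queue. -/
theorem write_prodTail (v u : List A) (l : List TileSymbol) {y x : List TileSymbol}
    (hy : ∀ a ∈ y, a ≠ 𝟎) (hx : body idx u = x ++ [𝐛, 𝐛]) :
    ∃ x', body idx (u ++ v) = x' ++ [𝐛, 𝐛] ∧
      Reaches Gap.step ⟨.L, 8, prodTail idx v ++ l, y ++ x ++ [𝟏]⟩
        ⟨.L, 8, l, ((prodTail idx v).map fill).reverse ++ y ++ x' ++ [𝟏]⟩ := by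
  induction v generalizing u x y with
  | nil => exact ⟨x, by simpa using hx, by simpa [prodTail] using! Relation.ReflTransGen.refl⟩
  | cons a v ih =>
    have hx₀ : ∀ a ∈ x, a ≠ 𝟎 := fun a ha =>
      body_ne_zero idx u a (by rw [hx]; exact List.mem_append_left _ ha)
    have h₁ := write_letter (marks idx a) (prodTail idx v ++ l) (x := y ++ x) (by
      intro c hc
      rcases List.mem_append.mp hc with h | h
      exacts [hy c h, hx₀ c h])
    obtain ⟨x', e, h₂⟩ := ih (u ++ [a]) (y := 𝐛 :: List.replicate (marks idx a + 2) 𝟏 ++ y)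
      (x := body idx u ++ List.replicate (marks idx a - 1) 𝟏) (by
        intro c hc
        simp only [List.cons_append, List.mem_cons, List.mem_append, List.mem_replicate] at hc
        rcases hc with rfl | ⟨-, rfl⟩ | h
        exacts [by simp, by simp, hy c h]) (by simp [body])
    refine ⟨x', by simpa using e, ?_⟩
    -- The last new mark is split off: it is the Road that the next separator will overwrite.
    have e' : marks idx a = marks idx a - 1 + 1 := by simp [marks]
    have e₁ : 𝐛 :: List.replicate (marks idx a + 2) 𝟏 ++ (y ++ x) ++ [𝐛, 𝐛] ++
        List.replicate (marks idx a) 𝟏 = 𝐛 :: List.replicate (marks idx a + 2) 𝟏 ++ y ++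
        (body idx u ++ List.replicate (marks idx a - 1) 𝟏) ++ [𝟏] := by
      conv_lhs => rw [e', List.replicate_succ' (n := marks idx a - 1), ← e']
      simp [hx]
    rw [e₁] at h₁
    have h₃ := h₁.trans h₂
    simpa [prodTail_cons, fill] using! h₃

end Tag

end CivBE

namespace CivBE

open StateTransition TileSymbol

local notation "𝟎" => TileSymbol.noImprovement
local notation "𝟏" => TileSymbol.road
local notation "𝐛" => TileSymbol.pillagedRoad

/-! ### Simulation of tag systems -/

section Tag

variable {A : Type} (idx : A → ℕ) (prod : A → List A)

/-- The passed part of the tape when the marks of a letter have been read. -/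
def passed (a : A) (cs : List (List TileSymbol)) : List TileSymbol :=
  List.replicate (marks idx a + 2) 𝟏 ++ cs.flatten.map fill

theorem flatten_passable {cs : List (List TileSymbol)} (hcs : ∀ c ∈ cs, Chunk c) :
    Passable (cs.flatten.map fill) := by
  induction cs with
  | nil => exact .nil
  | cons c cs ih =>
    simp only [List.mem_cons, forall_eq_or_imp] at hcs
    simpa using hcs.1.passable.append (ih hcs.2)

theorem flatten_clear_fill {cs : List (List TileSymbol)} (hcs : ∀ c ∈ cs, Chunk c) :
    (cs.flatten.map fill).map clear = cs.flatten := by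
  induction cs with
  | nil => rfl
  | cons c cs ih =>
    simp only [List.mem_cons, forall_eq_or_imp] at hcs
    simpa [-List.map_map, hcs.1.clear_fill] using ih hcs.2

theorem passed_passable (a : A) {cs : List (List TileSymbol)} (hcs : ∀ c ∈ cs, Chunk c) :
    Passable (passed idx a cs) :=
  (Passable.replicate _).append (flatten_passable hcs)

theorem data_cons (a : A) {w : List A} (hw : w ≠ []) :
    data idx (a :: w) = List.replicate (marks idx a - 1) 𝟏 ++ 𝐛 :: 𝐛 :: data idx w := by
  obtain ⟨x, hx⟩ := exists_body_eq idx hw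
  rw [data_eq idx hx, data_eq idx (x := List.replicate (marks idx a - 1) 𝟏 ++ 𝐛 :: 𝐛 :: x)
    (by simp [body_cons, hx])]
  simp

/-- The Road before the gap tile and the `marks idx a - 1` Roads of the letter together match the
chunks. The separator behind the letter is then turned into Roads, and state 4 supplies the
separator still missing at the end of the queue. -/
theorem find_production (a b : A) (w : List A) {cs : List (List TileSymbol)}
    (hcs : ∀ c ∈ cs, Chunk c) (hlen : cs.length = marks idx a) (l : List TileSymbol) :
    Reaches Gap.step ⟨.R, 0, 𝟏 :: (cs.flatten ++ l), 𝟏 :: 𝟎 :: data idx (a :: b :: w)⟩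
      ⟨.L, 5, l, (passed idx a cs).reverse ++ 𝟏 :: 𝟏 :: body idx (b :: w)⟩ := by
  obtain ⟨x, hx⟩ := exists_body_eq idx (List.cons_ne_nil b w)
  have hx₀ : ∀ a ∈ x, a ≠ 𝟎 := fun a ha =>
    body_ne_zero idx _ a (by rw [hx]; exact List.mem_append_left _ ha)
  rw [data_cons idx a (List.cons_ne_nil b w), data_eq idx hx, hx]
  obtain _ | ⟨c, cs⟩ := cs
  · simp [marks] at hlen
  have hp := passed_passable idx a hcs
  simp only [List.mem_cons, forall_eq_or_imp] at hcs
  have hlen' : cs.length = marks idx a - 1 := by simp at hlen; omega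
  -- The first mark is treated apart because an empty tile follows it, which state 0 simply fills.
  have h₁ := Chunk.read_mark (m := [𝟏]) (.one .nil) hcs.1 (cs.flatten ++ l)
    (𝟎 :: List.replicate (marks idx a - 1) 𝟏 ++ 𝐛 :: 𝐛 :: (x ++ [𝟏]))
  have h₂ := read_marks hcs.2 (m := 𝟏 :: 𝟏 :: 𝟏 :: c.map fill)
    (.one (.one (.one hcs.1.passable))) l (𝐛 :: 𝐛 :: (x ++ [𝟏]))
  -- Three Roads besides those of the letter: the one left of the gap, the first mark, and the
  -- filled tile.
  have e₁ : List.replicate (marks idx a - 1) 𝟏 ++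
      (𝟏 :: 𝟏 :: 𝟏 :: c.map fill ++ (cs.flatten.map fill ++ l)) =
      passed idx a (c :: cs) ++ l := by
    have : marks idx a - 1 + 1 + 1 + 1 = marks idx a + 2 := by simp [marks]
    simp [passed, replicate_append_cons, this]
  rw [hlen', e₁] at h₂
  have hp₀ := hp.ne_zero
  obtain ⟨m, hm⟩ : ∃ m, passed idx a (c :: cs) = 𝟏 :: m :=
    ⟨List.replicate (marks idx a + 1) 𝟏 ++ (c :: cs).flatten.map fill, rfl⟩
  have h₄ := sweep_five hp₀ l (𝟏 :: 𝟏 :: (x ++ [𝐛, 𝐛]))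
  have h₅ := write_separator (passed idx a (c :: cs) ++ l) (x := 𝟏 :: 𝟏 :: x)
    (by simpa using hx₀)
  -- State 3 repairs both pillaged Roads while moving left, and the Road with which the passed part
  -- begins sends it to state 4.
  have h₆ : Reaches Gap.step
      ⟨.R, 0, passed idx a (c :: cs) ++ l, 𝐛 :: 𝐛 :: (x ++ [𝟏])⟩
      ⟨.R, 4, passed idx a (c :: cs) ++ l, 𝟏 :: 𝟏 :: x ++ [𝟏]⟩ := by
    rw [hm]
    exact Gap.reaches_of_step rfl (Gap.reaches_of_step rfl (Gap.reaches_of_step rfl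
      (Gap.reaches_of_step rfl .refl)))
  have e₂ : 𝟏 :: ((c :: cs).flatten ++ l) = [𝟏] ++ (c ++ (cs.flatten ++ l)) := by simp
  rw [e₂]
  exact h₁.trans (Gap.reaches_of_step rfl (h₂.trans (h₆.trans (h₅.trans h₄))))

/-- The code of the productions of all the letters in the list `as`, read leftwards, and of the
letter that halts. -/
def library (as : List A) : List TileSymbol :=
  (as.flatMap fun a => prodCode idx (prod a)) ++ [𝟎, 𝟏]

/-- The tape with a word of the tag system. `n` accounts for the tiles where letters
have been erased. -/
def tagGap (as : List A) (n : ℕ) (w : List A) : Gap where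
  dir := .R
  state := 0
  l := 𝟏 :: (List.replicate (2 * n + 1) 𝟎 ++ 𝐛 :: 𝟎 :: 𝐛 :: library idx prod as)
  r := 𝟏 :: 𝟎 :: data idx w

/-- The chunks of the tape right of the productions of the letters in `as`. -/
def chunks (n : ℕ) (as : List A) : List (List TileSymbol) :=
  (List.replicate (2 * n + 1) 𝟎 ++ [𝐛]) :: [𝟎, 𝐛] ::
    as.flatMap fun a => prodChunks idx (prod a)

theorem chunk_of_mem_chunks {n : ℕ} {as : List A} : ∀ c ∈ chunks idx prod n as, Chunk c := by
  intro c hc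
  simp only [chunks, List.mem_cons, List.mem_flatMap] at hc
  rcases hc with rfl | rfl | ⟨a, -, h⟩
  exacts [.last n, .last 0, chunk_of_mem_prodChunks idx h]

/-- Two chunks for each production and two constant ones: exactly `marks` of a letter with number
`as.length`. -/
theorem chunks_length (n : ℕ) {as : List A} (h : ∀ a ∈ as, prod a ≠ []) :
    (chunks idx prod n as).length = 2 * as.length + 2 := by
  induction as with
  | nil => rfl
  | cons a as ih =>
    simp only [List.mem_cons, forall_eq_or_imp] at h
    have := ih h.2
    obtain ⟨c, v, hc⟩ := List.exists_cons_of_ne_nil h.1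
    simp only [chunks, List.length_cons, List.flatMap_cons, hc, prodChunks, List.length_append,
      List.length_nil] at this ⊢
    omega

theorem chunks_flatten (n : ℕ) (as : List A) :
    (chunks idx prod n as).flatten = List.replicate (2 * n + 1) 𝟎 ++ 𝐛 :: 𝟎 :: 𝐛 ::
      as.flatMap fun a => prodCode idx (prod a) := by
  have : (as.flatMap fun a => prodChunks idx (prod a)).flatten =
      as.flatMap fun a => prodCode idx (prod a) := by
    induction as with
    | nil => rfl
    | cons a as ih => simp [ih, prodChunks_flatten]
  simp [chunks, this]

/-- The marks of this letter exhaust all productions, so state 5 meets the final empty tile of the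
library, and state 6 the Road behind it. -/
theorem tagGap_halt {as : List A} (has : ∀ a ∈ as, prod a ≠ []) (n : ℕ) (a b : A) (w : List A)
    (ha : idx a = as.length) :
    ∃ x, Passable x ∧ Reaches Gap.step (tagGap idx prod as n (a :: b :: w))
      ⟨.L, 6, [𝟏], x.reverse ++ body idx (b :: w)⟩ := by
  refine ⟨𝟏 :: 𝟏 :: passed idx a (chunks idx prod n as) ++ [𝟏],
    (Passable.one (.one (passed_passable idx a (chunk_of_mem_chunks idx prod)))).append
      (.one .nil), ?_⟩
  have h := find_production idx a b w (chunk_of_mem_chunks idx prod)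
    (by rw [chunks_length idx prod n has, marks, ha]) [𝟎, 𝟏]
  have h' := h.trans (Gap.reaches_of_step rfl .refl)
  simpa [chunks_flatten, tagGap, library] using! h'

/-- By `hidx` the marks of `a` lead exactly to its production. The restoring sweep stops only at the
first separator left, the one behind `b`, and so erases `b` as well. The erased letters enlarge the
first block of empty tiles, hence `n' > n`. -/
theorem tagGap_step {as₁ as₂ : List A} {a : A} (has : ∀ a' ∈ as₁, prod a' ≠ [])
    (ha : prod a ≠ []) (hidx : idx a = as₁.length) (n : ℕ) (b : A) (w : List A) :
    ∃ n' > n, Reaches Gap.step (tagGap idx prod (as₁ ++ a :: as₂) n (a :: b :: w))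
      (tagGap idx prod (as₁ ++ a :: as₂) n' (w ++ prod a)) := by
  obtain ⟨c, v, hc⟩ := List.exists_cons_of_ne_nil ha
  set cs := chunks idx prod n as₁ with hcs
  have hcs' : ∀ c ∈ cs, Chunk c := chunk_of_mem_chunks idx prod
  set l := library idx prod as₂ with hl
  have hp := passed_passable idx a hcs'
  have h₁ := find_production idx a b w hcs'
    (by rw [chunks_length idx prod n has, marks, hidx]) (prodCode idx (prod a) ++ l)
  have hY : ∀ s ∈ (passed idx a cs).reverse ++ 𝟏 :: 𝟏 :: body idx (b :: w), s ≠ 𝟎 := by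
    simp only [List.mem_append, List.mem_reverse, List.mem_cons]
    rintro s (h | rfl | rfl | h)
    exacts [hp.ne_zero s h, by simp, by simp, body_ne_zero idx _ s h]
  have h₂ := write_block (marks idx c) (prodTail idx v ++ 𝟎 :: 𝐛 :: l) hY
  obtain ⟨x, hx, h₃⟩ := write_prodTail idx v (b :: w ++ [c]) (𝟎 :: 𝐛 :: l)
    (y := 𝐛 :: List.replicate (marks idx c + 1) 𝟏 ++ ((passed idx a cs).reverse ++ [𝟏, 𝟏]))
    (x := body idx (b :: w) ++ List.replicate (marks idx c - 1) 𝟏) (by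
      simp only [List.mem_append, List.mem_reverse, List.mem_cons, List.mem_replicate,
        List.cons_append]
      rintro s (rfl | ⟨-, rfl⟩ | h | rfl | rfl | h)
      exacts [by simp, by simp, hp.ne_zero s h, by simp, by simp, by simp at h])
    (by simp [body])
  obtain ⟨x', hx'⟩ := exists_body_eq idx (w := w ++ prod a) (by simp [ha])
  have ex : x = List.replicate (marks idx b - 1) 𝟏 ++ 𝐛 :: 𝐛 :: x' := by
    have : body idx (b :: (w ++ prod a)) = x ++ [𝐛, 𝐛] := by
      rw [← hx, hc]; simp
    rw [body_cons, hx'] at this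
    have := this.symm
    rw [← List.cons_append, ← List.cons_append, ← List.append_assoc] at this
    exact List.append_cancel_right this
  -- `m` is what the restoring sweep clears: from the tail of the production to the last mark of
  -- `b`.
  set m := List.replicate (marks idx b - 1) 𝟏 ++ (𝟏 :: 𝟏 :: passed idx a cs ++
    (List.replicate (marks idx c + 1) 𝟏 ++ 𝐛 :: (prodTail idx v).map fill)) with hm
  have hmp : Passable m := by
    refine (Passable.replicate _).append (.append (.one (.one hp)) ?_)
    have := (Passable.replicate_mark (marks idx c)).append (prodTail_passable idx v)
    simpa using this
  have h₄ := hmp.restore (𝟎 :: 𝐛 :: l) (𝐛 :: 𝐛 :: (x' ++ [𝟏]))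
  have e' : marks idx c = marks idx c - 1 + 1 := by simp [marks]
  have e₁ : 𝐛 :: List.replicate (marks idx c + 1) 𝟏 ++
      ((passed idx a cs).reverse ++ 𝟏 :: 𝟏 :: body idx (b :: w)) ++
      List.replicate (marks idx c) 𝟏 =
      𝐛 :: List.replicate (marks idx c + 1) 𝟏 ++ ((passed idx a cs).reverse ++ [𝟏, 𝟏]) ++
        (body idx (b :: w) ++ List.replicate (marks idx c - 1) 𝟏) ++ [𝟏] := by
    conv_lhs => rw [e', List.replicate_succ' (n := marks idx c - 1), ← e']
    simp
  have e₂ : ((prodTail idx v).map fill).reverse ++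
      (𝐛 :: List.replicate (marks idx c + 1) 𝟏 ++ ((passed idx a cs).reverse ++ [𝟏, 𝟏])) ++
      x ++ [𝟏] = m.reverse ++ 𝐛 :: 𝐛 :: (x' ++ [𝟏]) := by
    simp [hm, ex]
  rw [e₁] at h₂
  rw [e₂] at h₃
  -- An odd number of tiles is freed. One becomes the Road left of the gap; the rest is even, so the
  -- first block of the library keeps its odd length.
  have hmc : m.map clear = 𝟎 :: (List.replicate (2 * (idx a + idx b + 3)) 𝟎 ++ (cs.flatten ++
      (List.replicate (marks idx c + 1) 𝟎 ++ 𝐛 :: prodTail idx v))) := by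
    have e₃ : List.replicate (marks idx b - 1) 𝟎 ++ 𝟎 :: 𝟎 :: List.replicate (marks idx a + 2) 𝟎
        = 𝟎 :: List.replicate (2 * (idx a + idx b + 3)) 𝟎 := by
      rw [replicate_append_cons, replicate_append_cons, ← List.replicate_add,
        ← List.replicate_succ]
      congr 1
      simp only [marks]
      omega
    have e₄ := prodTail_clear_fill idx v
    have e₅ := flatten_clear_fill hcs'
    rw [← List.cons_append, ← e₃]
    simp only [hm, passed, List.map_append, List.map_cons, List.map_replicate, e₄, e₅, clear,
      List.append_assoc, List.cons_append]
  -- At the separator the states are 9, 8, 3, 3, 0: its two tiles become Road and empty, and the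
  -- tile before it a Road, as `tagGap` requires.
  have h₅ : Reaches Gap.step ⟨.R, 9, m.map clear ++ 𝟎 :: 𝐛 :: l, 𝐛 :: 𝐛 :: (x' ++ [𝟏])⟩
      ⟨.R, 0, 𝟏 :: (m.map clear).tail ++ 𝟎 :: 𝐛 :: l, 𝟏 :: 𝟎 :: (x' ++ [𝟏])⟩ := by
    rw [hmc]
    exact Gap.reaches_of_step rfl (Gap.reaches_of_step rfl (Gap.reaches_of_step rfl
      (Gap.reaches_of_step rfl .refl)))
  refine ⟨n + (idx a + idx b + 3), by omega, ?_⟩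
  have e₆ : tagGap idx prod (as₁ ++ a :: as₂) n (a :: b :: w) =
      ⟨.R, 0, 𝟏 :: (cs.flatten ++ (prodCode idx (prod a) ++ l)),
        𝟏 :: 𝟎 :: data idx (a :: b :: w)⟩ := by
    simp [tagGap, library, hcs, chunks_flatten, hl]
  have e₇ : tagGap idx prod (as₁ ++ a :: as₂) (n + (idx a + idx b + 3)) (w ++ prod a) =
      ⟨.R, 0, 𝟏 :: (m.map clear).tail ++ 𝟎 :: 𝐛 :: l, 𝟏 :: 𝟎 :: (x' ++ [𝟏])⟩ := by
    have : 2 * (n + (idx a + idx b + 3)) + 1 = 2 * (idx a + idx b + 3) + (2 * n + 1) := by ring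
    rw [hmc, hcs, chunks_flatten, ← data_eq idx hx']
    simp only [tagGap, library, hl, this, List.replicate_add, hc, prodCode, List.flatMap_append,
      List.flatMap_cons, List.append_assoc, List.cons_append, List.tail_cons, List.nil_append]
  rw [e₆, e₇]
  have e₈ : prodCode idx (prod a) ++ l = List.replicate (marks idx c + 1) 𝟎 ++
      𝐛 :: (prodTail idx v ++ 𝟎 :: 𝐛 :: l) := by
    simp [hc, prodCode]
  rw [e₈] at h₁ ⊢
  -- The three single steps turn the head at the end of the production: state 8 fills the closing
  -- tile, 9 meets the pillaged Road, and 8 empties the tile again.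
  exact h₁.trans (h₂.trans (h₃.trans (Gap.reaches_of_step rfl (Gap.reaches_of_step rfl
    (Gap.reaches_of_step rfl (h₄.trans h₅))))))

end Tag

end CivBE

namespace CivBE

open StateTransition TileSymbol

local notation "𝟎" => TileSymbol.noImprovement
local notation "𝟏" => TileSymbol.road
local notation "𝐛" => TileSymbol.pillagedRoad

/-! ### Counting separators -/

/-- Count the occurrences of two adjacent pillaged Roads; `s` holds the previous symbol and the
number of occurrences so far. -/
def countStep (s : TileSymbol × ℕ) (a : TileSymbol) : TileSymbol × ℕ :=
  (a, if s.1 = 𝐛 ∧ a = 𝐛 then s.2 + 1 else s.2)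

/-- The number of occurrences of two adjacent pillaged Roads. -/
def sepCount (x : List TileSymbol) : ℕ :=
  (x.foldl countStep (𝟎, 0)).2

/-- Pillaged Roads in a passable part are isolated. The induction has to carry along that the last
symbol is not pillaged. -/
theorem Passable.foldl_countStep {m : List TileSymbol} (h : Passable m) {c : TileSymbol}
    (hc : c ≠ 𝐛) (k : ℕ) : ∃ c' ≠ 𝐛, m.reverse.foldl countStep (c, k) = (c', k) := by
  induction h with
  | nil => exact ⟨c, hc, rfl⟩
  | one _ ih =>
    obtain ⟨c', -, h⟩ := ih
    exact ⟨𝟏, by simp, by simp [-List.foldl_reverse, List.foldl_append, h, countStep]⟩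
  | mark _ ih =>
    obtain ⟨c', hc', h⟩ := ih
    exact ⟨𝟏, by simp, by simp [-List.foldl_reverse, List.foldl_append, h, countStep, hc']⟩

theorem foldl_countStep_replicate (n : ℕ) (s : TileSymbol × ℕ) :
    (List.replicate (n + 1) 𝟏).foldl countStep s = (𝟏, s.2) := by
  induction n generalizing s with
  | zero => simp [countStep]
  | succ n ih => rw [List.replicate_succ, List.foldl_cons, ih]; simp [countStep]

/-- Each letter begins with at least one Road, so no pair straddles two letters and any starting `s`
will do. -/
theorem foldl_countStep_body {A : Type} (idx : A → ℕ) (w : List A) (s : TileSymbol × ℕ) :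
    ((body idx w).foldl countStep s).2 = s.2 + w.length := by
  induction w generalizing s with
  | nil => rfl
  | cons a w ih =>
    have : marks idx a - 1 = 2 * idx a + 1 := by simp [marks]
    rw [body_cons, List.foldl_append, this, foldl_countStep_replicate, List.foldl_cons,
      List.foldl_cons, ih]
    simp [countStep]
    omega

theorem sepCount_append_replicate (x : List TileSymbol) (n : ℕ) :
    sepCount (x ++ List.replicate n 𝟎) = sepCount x := by
  induction n with
  | zero => simp
  | succ n ih =>
    rw [List.replicate_succ', ← List.append_assoc, sepCount, List.foldl_append, ← ih]
    simp [countStep, sepCount]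

/-- Needed because `HasContent` determines a half tape only up to trailing blanks; padding to a
common length makes the lists equal. -/
theorem sepCount_congr {x y : List TileSymbol} (h : ∀ i, x.getD i 𝟎 = y.getD i 𝟎) :
    sepCount x = sepCount y := by
  have : x ++ List.replicate y.length 𝟎 = y ++ List.replicate x.length 𝟎 := by
    apply List.ext_getElem
    · simp [add_comm]
    · intro i h₁ h₂
      have hi := h i
      simp only [List.getD_eq_getElem?_getD] at hi
      simp only [List.getElem_append, List.getElem_replicate]
      split_ifs with h₃ h₄ h₄ <;> simp_all
  rw [← sepCount_append_replicate x y.length, this, sepCount_append_replicate]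

/-! ### Tag systems with a finite alphabet -/

section Tag

variable {A : Type}

/-- One step of a 2-tag system: the first letter, not the halting one, is read, the first two
letters are deleted, and the production of the first is appended. -/
def TagStep (prod : A → List A) (halt : A) (u v : List A) : Prop :=
  ∃ a b w, a ≠ halt ∧ u = a :: b :: w ∧ v = w ++ prod a

variable [Fintype A] [DecidableEq A]

/-- The letters with a production. -/
noncomputable def letters (halt : A) : List A := (Finset.univ.erase halt).toList

/-- The number of a letter. -/
noncomputable def letterIdx (halt a : A) : ℕ := (letters halt).idxOf a

/-- The tape with a word of a tag system with a finite alphabet. -/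
noncomputable def wordGap (prod : A → List A) (halt : A) : ℕ → List A → Gap :=
  tagGap (letterIdx halt) prod (letters halt)

theorem wordGap_step {prod : A → List A} {halt : A} (hprod : ∀ a, prod a ≠ []) {u v : List A}
    (h : TagStep prod halt u v) (n : ℕ) :
    ∃ n', Reaches₁ Gap.step (wordGap prod halt n u) (wordGap prod halt n' v) := by
  obtain ⟨a, b, w, ha, rfl, rfl⟩ := h
  have hmem : a ∈ letters halt := by simp [letters, ha]
  have hlt : letterIdx halt a < (letters halt).length := List.idxOf_lt_length_of_mem hmem
  have hsplit : letters halt = (letters halt).take (letterIdx halt a) ++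
      a :: (letters halt).drop (letterIdx halt a + 1) := by
    conv_lhs => rw [← List.take_append_drop (letterIdx halt a) (letters halt)]
    rw [List.drop_eq_getElem_cons hlt]
    simp [letterIdx]
  obtain ⟨n', hn, h⟩ := tagGap_step (letterIdx halt) prod
    (as₁ := (letters halt).take (letterIdx halt a))
    (as₂ := (letters halt).drop (letterIdx halt a + 1)) (fun _ _ => hprod _) (hprod a)
    (by rw [List.length_take, min_eq_left hlt.le]) n b w
  rw [← hsplit] at h
  refine ⟨n', ?_⟩
  -- At least one step is made, since `n' > n` makes the left list longer.
  rcases Relation.reflTransGen_iff_eq_or_transGen.mp h with h | h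
  · have := congrArg (fun g : Gap => g.l.length) h
    simp [tagGap] at this
    omega
  · exact h

theorem wordGap_reaches {prod : A → List A} {halt : A} (hprod : ∀ a, prod a ≠ [])
    {u v : List A} (h : Relation.TransGen (TagStep prod halt) u v) (n : ℕ) :
    ∃ n', Reaches₁ Gap.step (wordGap prod halt n u) (wordGap prod halt n' v) := by
  induction h with
  | single h => exact wordGap_step hprod h n
  | tail _ h ih =>
    obtain ⟨n₁, h₁⟩ := ih
    obtain ⟨n₂, h₂⟩ := wordGap_step hprod h n₁
    exact ⟨n₂, h₁.trans h₂⟩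

theorem wordGap_halt {prod : A → List A} {halt : A} (hprod : ∀ a, prod a ≠ []) (n : ℕ) (b : A)
    (w : List A) :
    ∃ x, Reaches Gap.step (wordGap prod halt n (halt :: b :: w)) ⟨.L, 6, [𝟏], x⟩ ∧
      sepCount (𝟏 :: x) = w.length + 1 := by
  obtain ⟨x, hx, h⟩ := tagGap_halt (letterIdx halt) prod (as := letters halt)
    (fun a _ => hprod a) n halt b w (List.idxOf_eq_length (by simp [letters]))
  refine ⟨_, h, ?_⟩
  obtain ⟨c, -, hc⟩ := hx.foldl_countStep (c := 𝟏) (by simp) 0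
  have e : countStep (𝟎, 0) 𝟏 = (𝟏, 0) := rfl
  rw [sepCount, List.foldl_cons, e, List.foldl_append, hc, foldl_countStep_body]
  simp

end Tag

end CivBE

namespace CivBE

open StateTransition

/-! ### Machines with two numbers -/

/-- An affine operation on two numbers, after which they may be swapped. -/
structure PairOp where
  mulX : ℕ
  addX : ℕ
  mulY : ℕ
  addY : ℕ
  swap : Bool
  mulX_pos : mulX ≠ 0
  mulY_pos : mulY ≠ 0

/-- Apply an operation. -/
def PairOp.apply (o : PairOp) (x y : ℕ) : ℕ × ℕ :=
  if o.swap then (o.mulY * y + o.addY, o.mulX * x + o.addX)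
  else (o.mulX * x + o.addX, o.mulY * y + o.addY)

/-- A machine with two numbers: in each step the last bit of the second number is
removed, and it determines the next state (`none` is the halting state) and
an operation on the numbers. -/
structure PairMachine (σ : Type) where
  next : σ → Bool → Option σ
  op : σ → Bool → PairOp

namespace PairMachine

variable {σ : Type} (M : PairMachine σ)

/-- One step. -/
def step : Option σ × ℕ × ℕ → Option (Option σ × ℕ × ℕ)
  | (none, _, _) => none
  | (some q, x, y) => some (M.next q y.bodd, (M.op q y.bodd).apply x y.div2)

/-- Kinds of letters. -/
inductive Kind
  | markX | unitX | markY | unitY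
  | oddMarkX | oddUnitX | oddMarkY | oddUnitY
  | swapMark | swapUnit
  deriving DecidableEq

instance : Fintype Kind where
  elems := {.markX, .unitX, .markY, .unitY, .oddMarkX, .oddUnitX, .oddMarkY, .oddUnitY,
    .swapMark, .swapUnit}
  complete k := by cases k <;> decide

/-- Letters of the tag system for the machine. -/
abbrev Letter (σ : Type) := Kind × Option σ × Bool

/-- The halting letter. -/
def haltLetter : Letter σ := (.markX, none, true)

/-- The word that stands for a configuration. -/
def word (q : Option σ) (x y : ℕ) : List (Letter σ) :=
  (.markX, q, true) :: List.replicate (2 * x + 1) (.unitX, q, true) ++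
    (.markY, q, true) :: List.replicate y (.unitY, q, true)

/-- The productions. -/
def prod : Letter σ → List (Letter σ)
  | (.markX, q, _) => [(.oddMarkX, q, true), (.oddMarkX, q, false)]
  | (.unitX, q, _) => [(.oddUnitX, q, true), (.oddUnitX, q, false)]
  | (.markY, q, _) => [(.oddMarkY, q, true), (.oddMarkY, q, false)]
  | (.unitY, q, _) => [(.oddUnitY, q, true), (.oddUnitY, q, false)]
  | (.oddMarkX, some q, c) => (if c then [] else [haltLetter]) ++
      if (M.op q c).swap then [(.swapMark, some q, c), (.swapMark, some q, c)]
      else (.markX, M.next q c, true) ::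
        List.replicate (2 * (M.op q c).addX + 1) (.unitX, M.next q c, true)
  | (.oddUnitX, some q, c) =>
      if (M.op q c).swap then [(.swapUnit, some q, c), (.swapUnit, some q, c)]
      else List.replicate (2 * (M.op q c).mulX) (.unitX, M.next q c, true)
  | (.oddMarkY, some q, c) =>
      if (M.op q c).swap then (.markX, M.next q c, true) ::
        List.replicate (2 * (M.op q c).addY + 1) (.unitX, M.next q c, true)
      else (.markY, M.next q c, true) ::
        List.replicate (M.op q c).addY (.unitY, M.next q c, true)
  | (.oddUnitY, some q, c) =>
      if (M.op q c).swap then List.replicate (2 * (M.op q c).mulY) (.unitX, M.next q c, true)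
      else List.replicate (M.op q c).mulY (.unitY, M.next q c, true)
  | (.swapMark, some q, c) => (.markY, M.next q c, true) ::
      List.replicate (M.op q c).addX (.unitY, M.next q c, true)
  | (.swapUnit, some q, c) => List.replicate (M.op q c).mulX (.unitY, M.next q c, true)
  | (_, none, _) => [haltLetter]

/-- This is what the positive multipliers in `PairOp` are for: an empty production would occupy no
chunks and spoil the count. -/
theorem prod_ne_nil (a : Letter σ) : M.prod a ≠ [] := by
  obtain ⟨k, q, c⟩ := a
  cases k <;> rcases q with _ | q <;> simp [prod] <;>
    first
    | (split_ifs <;> simp [(M.op q c).mulX_pos, (M.op q c).mulY_pos])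
    | simp [(M.op q c).mulX_pos]

/-- Every other letter of a word of even length. -/
def evens {α : Type} : List α → List α
  | a :: _ :: l => a :: evens l
  | _ => []

/-- A tag system reads every other letter of an initial part of even length. -/
theorem reflTransGen_evens {A : Type} {prod : A → List A} {halt : A} (l r : List A)
    (hl : Even l.length) (h : ∀ a ∈ evens l, a ≠ halt) :
    Relation.ReflTransGen (TagStep prod halt) (l ++ r) (r ++ (evens l).flatMap prod) := by
  induction l using evens.induct generalizing r with
  | case1 a b l ih =>
    simp only [evens, List.mem_cons, forall_eq_or_imp] at h
    have h' := ih (r ++ prod a) (by simpa [Nat.even_add_one] using hl) h.2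
    refine .head ⟨a, b, l ++ r, h.1, rfl, rfl⟩ ?_
    simpa [evens] using h'
  | case2 l hl' =>
    match l with
    | [] => simpa [evens] using! Relation.ReflTransGen.refl
    | [a] => simp at hl
    | a :: b :: l => exact absurd rfl (hl' a b l)

theorem evens_replicate_odd {α : Type} (a b : α) (n : ℕ) :
    evens (a :: List.replicate (2 * n + 1) b) = a :: List.replicate n b := by
  induction n generalizing a with
  | zero => rfl
  | succ n ih =>
    have : evens (a :: b :: b :: List.replicate (2 * n + 1) b) = _ := congrArg (a :: ·) (ih b)
    exact this

theorem evens_replicate_even {α : Type} (a b c : α) (n : ℕ) :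
    evens (a :: List.replicate (2 * n) b ++ [c]) = a :: List.replicate n b := by
  induction n generalizing a with
  | zero => rfl
  | succ n ih => exact congrArg (a :: ·) (ih b)

/-- `n` times a pair of letters. -/
def pairs {α : Type} (n : ℕ) (a b : α) : List α := (List.replicate n [a, b]).flatten

theorem pairs_succ {α : Type} (n : ℕ) (a b : α) : pairs (n + 1) a b = a :: b :: pairs n a b := by
  simp [pairs, List.replicate_succ]

theorem length_pairs {α : Type} (n : ℕ) (a b : α) : (pairs n a b).length = 2 * n := by
  simp [pairs, mul_comm]

theorem evens_pairs_append {α : Type} (n : ℕ) (a b : α) (l : List α) :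
    evens (pairs n a b ++ l) = List.replicate n a ++ evens l := by
  induction n with
  | zero => rfl
  | succ n ih => simp [pairs_succ, evens, ih, List.replicate_succ]

theorem evens_pairs {α : Type} (n : ℕ) (a b : α) : evens (pairs n a b) = List.replicate n a := by
  simpa [evens] using evens_pairs_append n a b []

/-- A shift by one letter makes the second components of the pairs the ones that are read. -/
theorem evens_pairs_shift {α : Type} (n : ℕ) (s a b u : α) :
    evens (s :: pairs n a b ++ [u]) = s :: List.replicate n b := by
  induction n generalizing s with
  | zero => rfl
  | succ n ih =>
    have := ih b
    simp only [List.cons_append] at this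
    simp [pairs_succ, evens, this, List.replicate_succ]

theorem flatMap_replicate {α β : Type} (f : α → List β) (n : ℕ) (a : α) :
    (List.replicate n a).flatMap f = (List.replicate n (f a)).flatten := by
  simp [List.flatMap]

/-! ### The passes of the tag system that make up one step -/

/-- The word after the first pass. -/
def firstWord (q : σ) (c : Bool) (x y : ℕ) : List (Letter σ) :=
  ((.oddMarkX, some q, true) :: (.oddMarkX, some q, false) ::
      pairs x (.oddUnitX, some q, true) (.oddUnitX, some q, false) ++
    ((.oddMarkY, some q, true) :: (.oddMarkY, some q, false) ::
      pairs y (.oddUnitY, some q, true) (.oddUnitY, some q, false)) : List (Letter σ)).drop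
        (if c then 0 else 1)

/-- The X part has even length, so `markY` is read in any case. If `y` is odd, the Y part is even
too; if `y` is even, its last reading also deletes the first `oddMarkX`. The parity of `y` has
become a phase. -/
theorem word_first_pass (q : σ) (x y : ℕ) :
    Relation.TransGen (TagStep M.prod haltLetter) (word (some q) x y)
      (firstWord q y.bodd x y.div2) := by
  have h₁ : Relation.TransGen (TagStep M.prod haltLetter) (word (some q) x y)
      ((.markY, some q, true) :: List.replicate y (.unitY, some q, true) ++
        ((.oddMarkX, some q, true) :: (.oddMarkX, some q, false) ::
          pairs x (.oddUnitX, some q, true) (.oddUnitX, some q, false))) := by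
    have h := reflTransGen_evens (prod := M.prod) (halt := haltLetter)
      ((.markX, some q, true) :: List.replicate (2 * x + 1) (.unitX, some q, true))
      ((.markY, some q, true) :: List.replicate y (.unitY, some q, true))
      (by simp [parity_simps])
      (by rw [evens_replicate_odd]; simp [haltLetter])
    rw [evens_replicate_odd, List.flatMap_cons, flatMap_replicate] at h
    rcases Relation.reflTransGen_iff_eq_or_transGen.mp h with h | h
    · simp [prod] at h
    · exact h
  refine h₁.trans_left ?_
  obtain ⟨k, rfl | rfl⟩ := Nat.even_or_odd' y
  · have h := reflTransGen_evens (prod := M.prod) (halt := haltLetter)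
      ((.markY, some q, true) :: List.replicate (2 * k) (.unitY, some q, true) ++
        [(.oddMarkX, some q, true)])
      ((.oddMarkX, some q, false) ::
          pairs x (.oddUnitX, some q, true) (.oddUnitX, some q, false))
      (by simp [parity_simps])
      (by rw [evens_replicate_even]; simp [haltLetter])
    rw [evens_replicate_even, List.flatMap_cons, flatMap_replicate] at h
    simpa [prod, firstWord, pairs, Nat.div2_val] using! h
  · have h := reflTransGen_evens (prod := M.prod) (halt := haltLetter)
      ((.markY, some q, true) :: List.replicate (2 * k + 1) (.unitY, some q, true))
      ((.oddMarkX, some q, true) :: (.oddMarkX, some q, false) ::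
          pairs x (.oddUnitX, some q, true) (.oddUnitX, some q, false))
      (by simp [parity_simps])
      (by rw [evens_replicate_odd]; simp [haltLetter])
    rw [evens_replicate_odd, List.flatMap_cons, flatMap_replicate] at h
    have e : (2 * k + 1).div2 = k := by simp [Nat.div2_val]
    simpa [prod, firstWord, pairs, e] using! h

/-- The word after the second pass. -/
def secondWord (q : σ) (c : Bool) (x y : ℕ) : List (Letter σ) :=
  (M.prod (.oddMarkX, some q, c)).drop (if c then 0 else 1) ++
    ((List.replicate x (M.prod (.oddUnitX, some q, c))).flatten ++
      (M.prod (.oddMarkY, some q, c) ++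
        (List.replicate y (M.prod (.oddUnitY, some q, c))).flatten))

/-- For `c = false` the reading is out of phase and ends inside a pair. The `haltLetter` that opens
the production of `oddMarkX` is padding: it is deleted as a second letter and never read. -/
theorem word_second_pass (q : σ) (c : Bool) (x y : ℕ) :
    Relation.ReflTransGen (TagStep M.prod haltLetter)
      (firstWord q c x y)
      (M.secondWord q c x y) := by
  cases c
  · have h₁ := reflTransGen_evens (prod := M.prod) (halt := haltLetter)
      ((.oddMarkX, some q, false) ::
        pairs x (.oddUnitX, some q, true) (.oddUnitX, some q, false) ++
        [(.oddMarkY, some q, true)])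
      ((.oddMarkY, some q, false) ::
          pairs y (.oddUnitY, some q, true) (.oddUnitY, some q, false))
      (by simp [parity_simps, length_pairs])
      (by rw [evens_pairs_shift]; simp [haltLetter])
    obtain ⟨v, hv⟩ : ∃ v, M.prod (.oddMarkX, some q, false) = haltLetter :: v := ⟨_, rfl⟩
    have h₂ := reflTransGen_evens (prod := M.prod) (halt := haltLetter)
      ((.oddMarkY, some q, false) ::
          pairs y (.oddUnitY, some q, true) (.oddUnitY, some q, false) ++ [haltLetter])
      (v ++ (List.replicate x (M.prod (.oddUnitX, some q, false))).flatten)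
      (by simp [parity_simps, length_pairs])
      (by rw [evens_pairs_shift]; simp [haltLetter])
    rw [evens_pairs_shift, List.flatMap_cons, flatMap_replicate, hv] at h₁
    rw [evens_pairs_shift, List.flatMap_cons, flatMap_replicate] at h₂
    simp only [secondWord, hv]
    simp only [List.cons_append, List.append_assoc, List.nil_append] at h₁ h₂
    simpa [firstWord] using h₁.trans h₂
  · have h := reflTransGen_evens (prod := M.prod) (halt := haltLetter)
      ((.oddMarkX, some q, true) :: (.oddMarkX, some q, false) ::
          (pairs x (.oddUnitX, some q, true) (.oddUnitX, some q, false) ++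
        ((.oddMarkY, some q, true) :: (.oddMarkY, some q, false) ::
          pairs y (.oddUnitY, some q, true) (.oddUnitY, some q, false)))) []
      (by simp [parity_simps, length_pairs])
      (by simp [evens, evens_pairs_append, evens_pairs, haltLetter, or_imp, forall_and])
    simp only [evens, evens_pairs_append, evens_pairs, List.flatMap_cons, List.flatMap_append,
      flatMap_replicate] at h
    simpa [secondWord, firstWord] using h

theorem flatten_replicate_replicate {α : Type} (m n : ℕ) (a : α) :
    (List.replicate m (List.replicate n a)).flatten = List.replicate (n * m) a := by
  simp [mul_comm]

/-- Without a swap the word is already in final form. With a swap the old Y part already consists of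
X letters, and one more pass over the doubled swap letters in front moves the old X part behind it
as Y letters. -/
theorem word_third_pass (q : σ) (c : Bool) (x y : ℕ) :
    Relation.ReflTransGen (TagStep M.prod haltLetter) (M.secondWord q c x y)
      (word (M.next q c) ((M.op q c).apply x y).1 ((M.op q c).apply x y).2) := by
  have e (u v : ℕ) : 2 * (u + v) + 1 = 2 * v + 1 + 2 * u := by ring
  cases hs : (M.op q c).swap
  · have : M.secondWord q c x y =
        word (M.next q c) ((M.op q c).apply x y).1 ((M.op q c).apply x y).2 := by
      have e₁ : (M.prod (.oddMarkX, some q, c)).drop (if c then 0 else 1) =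
          (.markX, M.next q c, true) ::
            List.replicate (2 * (M.op q c).addX + 1) (.unitX, M.next q c, true) := by
        cases c <;> simp [prod, hs]
      rw [secondWord, e₁]
      simp only [prod, hs, word, PairOp.apply, flatten_replicate_replicate, e,
        Bool.false_eq_true, if_false, List.replicate_add, List.cons_append, List.append_assoc,
        mul_assoc, add_comm ((M.op q c).mulY * y)]
    rw [this]
  · have h := reflTransGen_evens (prod := M.prod) (halt := haltLetter)
      ((.swapMark, some q, c) :: (.swapMark, some q, c) ::
        pairs x (.swapUnit, some q, c) (.swapUnit, some q, c))
      ((.markX, M.next q c, true) ::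
        List.replicate (2 * ((M.op q c).mulY * y + (M.op q c).addY) + 1)
          (.unitX, M.next q c, true))
      (by simp [parity_simps, length_pairs])
      (by simp [evens, evens_pairs, haltLetter, or_imp, forall_and])
    have e₁ : (M.prod (.oddMarkX, some q, c)).drop (if c then 0 else 1) =
          [(.swapMark, some q, c), (.swapMark, some q, c)] := by
        cases c <;> simp [prod, hs]
    simp only [evens, evens_pairs, List.flatMap_cons, flatMap_replicate, prod] at h
    simp only [secondWord, e₁]
    simp only [prod, hs, word, PairOp.apply, flatten_replicate_replicate, e,
        if_true, List.replicate_add, List.cons_append, List.append_assoc,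
        mul_assoc, pairs, List.nil_append,
        add_comm ((M.op q c).mulX * x)] at h ⊢
    exact h

theorem word_step (q : σ) (x y : ℕ) :
    Relation.TransGen (TagStep M.prod haltLetter) (word (some q) x y)
      (word (M.next q y.bodd) ((M.op q y.bodd).apply x y.div2).1
        ((M.op q y.bodd).apply x y.div2).2) :=
  ((M.word_first_pass q x y).trans_left (M.word_second_pass q _ x _)).trans_left
    (M.word_third_pass q _ x _)

end PairMachine

end CivBE

namespace CivBE

open StateTransition TileSymbol

local notation "𝟎" => TileSymbol.noImprovement
local notation "𝟏" => TileSymbol.road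
local notation "𝐛" => TileSymbol.pillagedRoad

/-! ### From machines with two numbers to the machine of the command table -/

namespace PairMachine

variable {σ : Type} [Fintype σ] [DecidableEq σ] (M : PairMachine σ)

/-- The configurations of the machine of the command table that simulate a configuration of a
machine with two numbers. -/
def Simulates : Option σ × ℕ × ℕ → Cfg (Fin 10) TileSymbol → Prop
  | (some q, x, y), c =>
      ∃ n p, c = (wordGap M.prod haltLetter n (word (some q) x y)).toCfg p
  | (none, x, y), c =>
      ∃ r p, c = (Gap.mk .L 6 [𝟏] r).toCfg p ∧ sepCount (𝟏 :: r) = 2 * x + y + 2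

theorem reaches_toCfg {g g' : Gap} (h : Reaches Gap.step g g') (p : ℤ) :
    ∃ p', Reaches civMachine.step (g.toCfg p) (g'.toCfg p') := by
  obtain ⟨_, ⟨p', rfl⟩, h⟩ := tr_reaches Gap.respects ⟨p, rfl⟩ h
  exact ⟨p', h⟩

theorem reaches₁_toCfg {g g' : Gap} (h : Reaches₁ Gap.step g g') (p : ℤ) :
    ∃ p', Reaches₁ civMachine.step (g.toCfg p) (g'.toCfg p') := by
  obtain ⟨_, ⟨p', rfl⟩, h⟩ := tr_reaches₁ Gap.respects ⟨p, rfl⟩ h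
  exact ⟨p', h⟩

/-- A word that begins with the halting letter is not yet a halted tape, so for `none` the run is
continued to the halt. -/
theorem exists_simulates (q : Option σ) (x y n : ℕ) (p : ℤ) :
    ∃ c, M.Simulates (q, x, y) c ∧
      Reaches civMachine.step ((wordGap M.prod haltLetter n (word q x y)).toCfg p) c := by
  cases q with
  | some q => exact ⟨_, ⟨n, p, rfl⟩, .refl⟩
  | none =>
    obtain ⟨r, h, hr⟩ := wordGap_halt (halt := haltLetter) M.prod_ne_nil n (.unitX, none, true)
      (List.replicate (2 * x) (.unitX, none, true) ++
        (.markY, none, true) :: List.replicate y (.unitY, none, true))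
    obtain ⟨p', h'⟩ := reaches_toCfg h p
    refine ⟨_, ⟨r, p', rfl, ?_⟩, h'⟩
    rw [hr]
    simp only [List.length_append, List.length_cons, List.length_replicate]
    omega

theorem simulates_respects : Respects M.step civMachine.step M.Simulates := by
  rintro ⟨q, x, y⟩ c h
  cases q with
  | none =>
    obtain ⟨r, p, rfl, -⟩ := h
    exact (Gap.toCfg_step p _).1 rfl
  | some q =>
    obtain ⟨n, p, rfl⟩ := h
    obtain ⟨n', h₁⟩ := wordGap_reaches M.prod_ne_nil (M.word_step q x y) n
    obtain ⟨p', h₁⟩ := reaches₁_toCfg h₁ p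
    obtain ⟨c, hc, h₂⟩ := M.exists_simulates (M.next q y.bodd)
      ((M.op q y.bodd).apply x y.div2).1 ((M.op q y.bodd).apply x y.div2).2 n' p'
    exact ⟨c, hc, h₁.trans_left h₂⟩

/-- The initial tape of the machine of the command table for the pair of numbers `(0, y)`. -/
noncomputable def tape (q : σ) (y : ℕ) : List TileSymbol × List TileSymbol :=
  ((wordGap M.prod haltLetter 0 (word (some q) 0 y)).l,
    (wordGap M.prod haltLetter 0 (word (some q) 0 y)).r)

theorem simulates_init (q : σ) (y : ℕ) :
    M.Simulates (some q, 0, y) (civMachine.init (M.tape q y)) :=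
  ⟨0, 0, Gap.toCfg_init _ _⟩

theorem haltsAt_iff_mem_eval {Q Γ : Type} (T : TuringMachine Q Γ) (c d : Cfg Q Γ) :
    T.HaltsAt c d ↔ d ∈ eval T.step c :=
  mem_eval.symm

theorem halts_iff (q : σ) (y : ℕ) :
    (∃ d, civMachine.HaltsAt (civMachine.init (M.tape q y)) d) ↔
      (eval M.step (some q, 0, y)).Dom := by
  simp only [haltsAt_iff_mem_eval, ← Part.dom_iff_mem]
  exact tr_eval_dom M.simulates_respects (M.simulates_init q y)

theorem sepCount_of_halts {q : σ} {y x' y' : ℕ} {q' : Option σ} {d : Cfg (Fin 10) TileSymbol}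
    {z : List TileSymbol × List TileSymbol}
    (hd : civMachine.HaltsAt (civMachine.init (M.tape q y)) d)
    (h : (q', x', y') ∈ eval M.step (some q, 0, y)) (hz : civMachine.HasContent d z) :
    sepCount z.2 = 2 * x' + y' + 2 := by
  obtain ⟨d', hd', hmem⟩ := tr_eval M.simulates_respects (M.simulates_init q y) h
  obtain rfl := Part.mem_unique hmem ((haltsAt_iff_mem_eval _ _ _).mp hd)
  cases q' with
  | some q' => simp [mem_eval, step] at h
  | none =>
    obtain ⟨r, p, rfl, hr⟩ := hd'
    rw [← hr]
    refine sepCount_congr fun i => ?_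
    refine (hz i).1.symm.trans ?_
    cases i with
    | zero => simp [Gap.toCfg, gapTape]
    | succ i => simp [Gap.toCfg, gapTape]

end PairMachine

end CivBE

namespace CivBE

open StateTransition Turing

/-! ### Turing machines with two symbols -/

/-- The number with the given binary digits, the last one first. -/
def bitsNum (l : List Bool) : ℕ := l.foldr Nat.bit 0

theorem bitsNum_append_replicate (l : List Bool) (n : ℕ) :
    bitsNum (l ++ List.replicate n false) = bitsNum l := by
  have : List.foldr Nat.bit 0 (List.replicate n false) = 0 := by
    induction n with
    | zero => rfl
    | succ n ih => simp [List.replicate_succ, ih]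
  simp [bitsNum, this]

/-- The number whose binary digits are written on a half of the tape. -/
def blankNum (l : ListBlank Bool) : ℕ :=
  l.liftOn bitsNum (by
    rintro a _ ⟨n, rfl⟩
    exact (bitsNum_append_replicate a n).symm)

theorem blankNum_mk (l : List Bool) : blankNum (ListBlank.mk l) = bitsNum l := rfl

theorem blankNum_cons (b : Bool) (l : ListBlank Bool) :
    blankNum (l.cons b) = Nat.bit b (blankNum l) := by
  induction l using ListBlank.induction_on
  rfl

theorem blankNum_eq (l : ListBlank Bool) : blankNum l = Nat.bit l.head (blankNum l.tail) := by
  rw [← blankNum_cons, ListBlank.cons_head_tail]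

/-- Write the bit `b` back. -/
def PairOp.keep (b swap : Bool) : PairOp := ⟨1, 0, 2, b.toNat, swap, by simp, by simp⟩

/-- Append the bit `b` to the other number. -/
def PairOp.push (b swap : Bool) : PairOp := ⟨2, b.toNat, 1, 0, swap, by simp, by simp⟩

theorem PairOp.keep_apply (b : Bool) (x y : ℕ) :
    (PairOp.keep b false).apply x y = (x, Nat.bit b y) := by
  simp [PairOp.apply, PairOp.keep, Nat.bit_val]

theorem PairOp.keep_swap_apply (b : Bool) (x y : ℕ) :
    (PairOp.keep b true).apply x y = (Nat.bit b y, x) := by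
  simp [PairOp.apply, PairOp.keep, Nat.bit_val]

theorem PairOp.push_apply (b : Bool) (x y : ℕ) :
    (PairOp.push b false).apply x y = (Nat.bit b x, y) := by
  simp [PairOp.apply, PairOp.push, Nat.bit_val]

theorem PairOp.push_swap_apply (b : Bool) (x y : ℕ) :
    (PairOp.push b true).apply x y = (y, Nat.bit b x) := by
  simp [PairOp.apply, PairOp.push, Nat.bit_val]

section

variable {Λ : Type} [Inhabited Λ] [DecidableEq Λ] (M : TM0.Machine Bool Λ) (S : Finset Λ)

/-- A state in the finite set `S`. -/
def restrict (b : Bool) (q : Λ) : Option (S × Bool) :=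
  if h : q ∈ S then some (⟨q, h⟩, b) else none

/-- The machine with two numbers for a Turing machine with two symbols. The states `(q, true)`
move the head to the left. -/
def TM0.pairMachine : PairMachine (S × Bool) where
  next
    | (q, false), b => match M q b with
      | none => none
      | some (q', .move .left) => restrict S true q'
      | some (q', _) => restrict S false q'
    | (q, true), _ => some (q, false)
  op
    | (q, false), b => match M q b with
      | none => .keep b false
      | some (_, .move .left) => .keep b true
      | some (_, .move .right) => .push b false
      | some (_, .write a) => .keep a false
    | (_, true), b => .push b true

variable {M S}

/-- The scanned symbol is the last bit of the second number. Only that number can be popped, so a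
move to the left takes two steps: the halves are swapped, a bit of the left half is moved to the
right half, and they are swapped back. -/
theorem TM0.pairMachine_reaches {q q' : Λ} (hq : q ∈ S) (hq' : q' ∈ S) {T T' : Tape Bool}
    (h : TM0.step M ⟨q, T⟩ = some ⟨q', T'⟩) :
    Reaches₁ (TM0.pairMachine M S).step
      (some (⟨q, hq⟩, false), blankNum T.left, blankNum T.right₀)
      (some (⟨q', hq'⟩, false), blankNum T'.left, blankNum T'.right₀) := by
  obtain ⟨L, R, rfl⟩ := T.exists_mk'
  simp only [TM0.step, Tape.mk'_head, Option.map_eq_some_iff, TM0.Cfg.mk.injEq] at h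
  obtain ⟨⟨q₁, s⟩, hM, e, hT⟩ := h
  dsimp only at e
  subst e
  rcases s with (_ | _) | a <;> dsimp only at hT <;> subst hT
  · refine (Relation.TransGen.single (b := (some (⟨q₁, hq'⟩, true), blankNum R, blankNum L))
      ?_).tail ?_
    · change _ = _
      rw [Tape.mk'_left, Tape.mk'_right₀, blankNum_eq R]
      simp [PairMachine.step, TM0.pairMachine, hM, restrict, hq', PairOp.keep_swap_apply]
    · change _ = _
      rw [Tape.move_left_mk', Tape.mk'_left, Tape.mk'_right₀, blankNum_cons, blankNum_eq L]
      simp [PairMachine.step, TM0.pairMachine, PairOp.push_swap_apply]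
  · refine .single ?_
    change _ = _
    rw [Tape.move_right_mk', Tape.mk'_left, Tape.mk'_right₀, Tape.mk'_left, Tape.mk'_right₀,
      blankNum_cons, blankNum_eq R]
    simp [PairMachine.step, TM0.pairMachine, hM, restrict, hq', PairOp.push_apply]
  · refine .single ?_
    change _ = _
    rw [Tape.write_mk', Tape.mk'_left, Tape.mk'_right₀,
      Tape.mk'_left, Tape.mk'_right₀, blankNum_cons, blankNum_eq R]
    simp [PairMachine.step, TM0.pairMachine, hM, restrict, hq', PairOp.keep_apply]

theorem TM0.pairMachine_halts {q : Λ} (hq : q ∈ S) {T : Tape Bool}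
    (h : TM0.step M ⟨q, T⟩ = none) :
    (TM0.pairMachine M S).step
      (some (⟨q, hq⟩, false), blankNum T.left, blankNum T.right₀) =
      some (none, blankNum T.left, blankNum T.right₀) := by
  obtain ⟨L, R, rfl⟩ := T.exists_mk'
  simp only [TM0.step, Tape.mk'_head, Option.map_eq_none_iff] at h
  rw [Tape.mk'_left, Tape.mk'_right₀, blankNum_eq R]
  simp [PairMachine.step, TM0.pairMachine, h, PairOp.keep_apply]

/-- The configuration of the machine with two numbers for a configuration of the
Turing machine; the halting state is entered as soon as the Turing machine has halted. -/
def TM0.PairCfg (M : TM0.Machine Bool Λ) (S : Finset Λ) (c : TM0.Cfg Bool Λ)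
    (d : Option (S × Bool) × ℕ × ℕ) : Prop :=
  (TM0.step M c = none ∧ d = (none, blankNum c.Tape.left, blankNum c.Tape.right₀)) ∨
  TM0.step M c ≠ none ∧ ∃ hq : c.q ∈ S,
    d = (some (⟨c.q, hq⟩, false), blankNum c.Tape.left, blankNum c.Tape.right₀)

/-- The machine with two numbers needs an extra step to notice that the Turing machine has halted;
it is appended here, as `Respects` relates halted configurations only to halted ones. -/
theorem TM0.exists_pairCfg {c : TM0.Cfg Bool Λ} (hq : c.q ∈ S) :
    ∃ d, TM0.PairCfg M S c d ∧ Reaches (TM0.pairMachine M S).step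
      (some (⟨c.q, hq⟩, false), blankNum c.Tape.left, blankNum c.Tape.right₀) d := by
  by_cases h : TM0.step M c = none
  · exact ⟨_, .inl ⟨h, rfl⟩, .single (TM0.pairMachine_halts hq h)⟩
  · exact ⟨_, .inr ⟨h, hq, rfl⟩, .refl⟩

theorem TM0.pairCfg_respects (hS : TM0.Supports M (S : Set Λ)) :
    Respects (TM0.step M) (TM0.pairMachine M S).step (TM0.PairCfg M S) := by
  rintro c d (⟨h, rfl⟩ | ⟨h, hq, rfl⟩)
  · rw [h]
    rfl
  · obtain ⟨c', hc'⟩ := Option.ne_none_iff_exists'.mp h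
    have hq' : c'.q ∈ S := TM0.step_supports M hS hc' hq
    obtain ⟨d, hd, h'⟩ := TM0.exists_pairCfg (M := M) hq'
    rw [hc']
    exact ⟨d, hd, (TM0.pairMachine_reaches hq hq' hc').trans_left h'⟩

theorem TM0.pairMachine_eval_dom (hS : TM0.Supports M (S : Set Λ)) {c : TM0.Cfg Bool Λ}
    (hq : c.q ∈ S) :
    (eval (TM0.pairMachine M S).step
      (some (⟨c.q, hq⟩, false), blankNum c.Tape.left, blankNum c.Tape.right₀)).Dom ↔
      (eval (TM0.step M) c).Dom := by
  obtain ⟨d, hd, h⟩ := TM0.exists_pairCfg (M := M) hq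
  rw [reaches_eval h]
  exact tr_eval_dom (TM0.pairCfg_respects hS) hd

theorem TM0.pairMachine_mem_eval (hS : TM0.Supports M (S : Set Λ)) {c c' : TM0.Cfg Bool Λ}
    (hq : c.q ∈ S) (h' : c' ∈ eval (TM0.step M) c) :
    (none, blankNum c'.Tape.left, blankNum c'.Tape.right₀) ∈ eval (TM0.pairMachine M S).step
      (some (⟨c.q, hq⟩, false), blankNum c.Tape.left, blankNum c.Tape.right₀) := by
  obtain ⟨d, hd, h⟩ := TM0.exists_pairCfg (M := M) hq
  rw [reaches_eval h]
  obtain ⟨d', hd', h''⟩ := tr_eval (TM0.pairCfg_respects hS) hd h'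
  have := (mem_eval.mp h').2
  rcases hd' with ⟨-, rfl⟩ | ⟨hne, -⟩
  · exact h''
  · exact absurd this hne

end

end CivBE

namespace CivBE

/-! ### Numbers with coded binary digits -/

section

variable (b d : ℕ) (B : Bool → ℕ)

/-- The number with the digits `d` and `B` of the binary digits of `n`, the first of them
last, in base `b`. -/
def digitCode (n : ℕ) : ℕ := d + b * n.bits.foldl (fun a c => B c + b * a) 0

/-- Move a binary digit from the first number to the second. -/
def digitCodeStep (x : ℕ × ℕ) : ℕ × ℕ :=
  if x.1 = 0 then x else (x.1.div2, B x.1.bodd + b * x.2)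

/-- Once the first number is `0` nothing changes, so `n` itself can serve as the number of
iterations. -/
theorem digitCodeStep_iterate (k n a : ℕ) (h : n ≤ k) :
    (digitCodeStep b B)^[k] (n, a) = (0, n.bits.foldl (fun a c => B c + b * a) a) := by
  induction k generalizing n a with
  | zero =>
    obtain rfl : n = 0 := by omega
    simp
  | succ k ih =>
    rw [Function.iterate_succ_apply, digitCodeStep]
    rcases eq_or_ne n 0 with rfl | hn
    · rw [if_pos rfl, ih 0 a (by omega)]
    · have hd := Nat.bodd_add_div2 n
      have hb : n.bodd.toNat ≤ 1 := Bool.toNat_le _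
      rw [if_neg hn, ih _ _ (by dsimp only; omega)]
      conv_rhs => rw [← Nat.bit_bodd_div2 n]
      rw [Nat.bits_append_bit]
      · rfl
      · intro h0
        cases e : n.bodd
        · simp only [e, h0, Bool.toNat_false] at hd
          omega
        · rfl

theorem primrec_digitCode : Primrec (digitCode b d B) := by
  have hB : Primrec B := Primrec.dom_finite B
  have hs : Primrec (digitCodeStep b B) := by
    refine Primrec.ite (Primrec.eq.comp .fst (.const 0)) .id (.pair (Primrec.nat_div2.comp .fst) ?_)
    exact Primrec.nat_add.comp (hB.comp (Primrec.nat_bodd.comp .fst))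
      (Primrec.nat_mul.comp (.const b) .snd)
  have : Primrec fun n => d + b * ((digitCodeStep b B)^[n] (n, 0)).2 :=
    Primrec.nat_add.comp (.const d) (Primrec.nat_mul.comp (.const b)
      (Primrec.snd.comp (Primrec.nat_iterate .id (.pair .id (.const 0)) (hs.comp .snd))))
  refine this.of_eq fun n => ?_
  rw [digitCodeStep_iterate b B n n 0 le_rfl, digitCode]

theorem digitCode_eq_ofDigits (n : ℕ) :
    digitCode b d B n = Nat.ofDigits b (d :: n.bits.reverse.map B) := by
  simp [digitCode, Nat.ofDigits_eq_foldr, List.foldl_map]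

variable {b d B}

/-- Nonzero digits exclude leading zeros, so the digit list is recovered exactly. -/
theorem digits_digitCode (hd : d ≠ 0) (hdb : d < b) (hB : ∀ c, B c ≠ 0) (hBb : ∀ c, B c < b)
    (n : ℕ) : b.digits (digitCode b d B n) = d :: n.bits.reverse.map B := by
  rw [digitCode_eq_ofDigits]
  refine Nat.digits_ofDigits b (by omega) _ ?_ fun h => ?_
  · simp only [List.mem_cons, List.mem_map]
    rintro l (rfl | ⟨c, -, rfl⟩)
    · exact hdb
    · exact hBb c
  · have := List.getLast_mem h
    simp only [List.mem_cons, List.mem_map] at this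
    rcases this with h | ⟨c, -, h⟩
    · rwa [h]
    · rw [← h]
      exact hB c

theorem le_digitCode (hd : d ≠ 0) (hdb : d < b) (hB : ∀ c, B c ≠ 0) (hBb : ∀ c, B c < b)
    (n : ℕ) : n ≤ digitCode b d B n := by
  have hb : 1 < b := by omega
  have h : n.size < (b.digits (digitCode b d B n)).length := by
    simp [digits_digitCode hd hdb hB hBb, Nat.size_eq_bits_len]
  exact (Nat.lt_size_self n).le.trans
    ((Nat.pow_le_pow_left hb _).trans ((Nat.lt_digits_length_iff hb _).mp h))

/-- The inverse is a bounded search, since `le_digitCode` bounds the argument by its code;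
uniqueness comes from the digits. -/
theorem exists_primrec_leftInverse_digitCode (hd : d ≠ 0) (hdb : d < b) (hB : ∀ c, B c ≠ 0)
    (hBb : ∀ c, B c < b)
    (hinj : Function.Injective B) :
    ∃ G : ℕ → ℕ, Primrec G ∧ ∀ n, G (digitCode b d B n) = n := by
  have hE := primrec_digitCode b d B
  refine ⟨fun y => Nat.findGreatest (fun n => digitCode b d B n = y) y,
    Primrec.nat_findGreatest .id (Primrec.eq.comp (hE.comp .snd) .fst), fun n => ?_⟩
  have h := Nat.findGreatest_spec (P := fun m => digitCode b d B m = digitCode b d B n)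
    (le_digitCode hd hdb hB hBb n) rfl
  have h' := digits_digitCode hd hdb hB hBb n
  rw [← h, digits_digitCode hd hdb hB hBb, List.cons.injEq] at h'
  have h'' := List.reverse_injective (List.map_injective_iff.mpr hinj h'.2)
  rw [← Nat.digits_inj_iff (b := 2), Nat.digits_two_eq_bits, Nat.digits_two_eq_bits, h'']

end

end CivBE

namespace CivBE

open StateTransition Turing

/-! ### Partial recursive functions on machines with two numbers -/

theorem bitsNum_append (l l' : List Bool) :
    bitsNum (l ++ l') = bitsNum l + 2 ^ l.length * bitsNum l' := by
  induction l with
  | nil => simp [bitsNum]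
  | cons b l ih =>
    have (l : List Bool) : bitsNum (b :: l) = Nat.bit b (bitsNum l) := rfl
    rw [List.cons_append, this, this, ih, Nat.bit_val, Nat.bit_val, List.length_cons]
    ring

theorem bitsNum_lt (l : List Bool) : bitsNum l < 2 ^ l.length := by
  induction l with
  | nil => simp [bitsNum]
  | cons b l ih =>
    have : bitsNum (b :: l) = Nat.bit b (bitsNum l) := rfl
    have hb := Bool.toNat_le b
    rw [this, Nat.bit_val, List.length_cons, pow_succ]
    omega

theorem bitsNum_injOn {l l' : List Bool} (h : l.length = l'.length)
    (e : bitsNum l = bitsNum l') : l = l' := by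
  induction l generalizing l' with
  | nil => exact (List.length_eq_zero_iff.mp h.symm).symm
  | cons b l ih =>
    cases l' with
    | nil => simp at h
    | cons b' l' =>
      have (b : Bool) (l : List Bool) : bitsNum (b :: l) = Nat.bit b (bitsNum l) := rfl
      rw [this, this] at e
      have hb : b = b' := by simpa using congrArg Nat.bodd e
      have hl : bitsNum l = bitsNum l' := by simpa using congrArg Nat.div2 e
      rw [hb, ih (by simpa using h) hl]

theorem bitsNum_flatMap {α : Type*} (f : α → List Bool) (m : ℕ) (hf : ∀ a, (f a).length = m)
    (l : List α) :
    bitsNum (l.flatMap f) = Nat.ofDigits (2 ^ m) (l.map fun a => bitsNum (f a)) := by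
  induction l with
  | nil => simp [bitsNum]
  | cons a l ih =>
    rw [List.flatMap_cons, bitsNum_append, ih, hf, List.map_cons, Nat.ofDigits_cons]

/-! ### The main stack of the compiled machine as a number -/

namespace PartrecToTM2

open Turing.PartrecToTM2

/-- The stack symbol of a binary digit. -/
def bitSymbol (b : Bool) : Γ' := cond b .bit1 .bit0

theorem trPosNum_eq_map_bits (n : PosNum) : trPosNum n = (n : ℕ).bits.map bitSymbol := by
  induction n with
  | one => simp [trPosNum, bitSymbol]
  | bit0 n ih =>
    rw [trPosNum, ih, PosNum.cast_bit0, ← two_mul, Nat.bit0_bits _ (PosNum.cast_pos n).ne']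
    rfl
  | bit1 n ih =>
    rw [trPosNum, ih, PosNum.cast_bit1, ← two_mul, Nat.bit1_bits]
    rfl

theorem trNat_eq_map_bits (n : ℕ) : trNat n = n.bits.map bitSymbol := by
  rw [trNat]
  conv_rhs => rw [← Num.to_of_nat n]
  cases (n : Num) with
  | zero => simp [trNum]
  | pos m => exact trPosNum_eq_map_bits m

instance : Fintype K' where
  elems := {K'.main, K'.rev, K'.aux, K'.stack}
  complete := by rintro (_ | _ | _ | _) <;> simp

/-- The symbols of all the stacks at a height where only the main stack has one. -/
def mainSymbol (a : Γ') : ∀ k : K', Option ((fun _ => Γ') k) :=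
  Function.update default .main (some a)

/-- The contents of the stacks when only the main stack is in use. -/
def mainStack (l : List Γ') : ListBlank (∀ k : K', Option ((fun _ => Γ') k)) :=
  ListBlank.mk (l.reverse.map mainSymbol)

theorem map_proj_mainStack (l : List Γ') (k : K') :
    (mainStack l).map (proj k) = ListBlank.mk ((K'.elim l [] [] [] k).map some).reverse := by
  rw [mainStack, ListBlank.map_mk, List.map_map]
  refine ListBlank.ext fun i => ?_
  rw [ListBlank.nth_mk, ListBlank.nth_mk]
  cases k
  · rw [← List.map_reverse]
    rfl
  all_goals
    simp only [List.getI_eq_getElem?_getD, List.getElem?_map, K'.elim]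
    cases l.reverse[i]? <;> rfl

/-- The simulation describes the halting tape only through its projections to the stacks; these
determine it. -/
theorem eq_mainStack {l : List Γ'} {L : ListBlank (∀ k : K', Option ((fun _ => Γ') k))}
    (h : ∀ k, L.map (proj k) = ListBlank.mk ((K'.elim l [] [] [] k).map some).reverse) :
    L = mainStack l := by
  refine ListBlank.ext fun i => funext fun k => ?_
  rw [← proj_map_nth, ← proj_map_nth, h, map_proj_mainStack]

/-- The tape symbol, with or without the marker of the bottom, where only the main stack has
a symbol. -/
def tapeSymbol (b : Bool) (a : Γ') : TM2to1.Γ' K' (fun _ => Γ') := (b, mainSymbol a)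

/-- Stacks are stored bottom first: the delimiter `cons` carries the bottom marker and the binary
digits follow in reverse. -/
theorem addBottom_mainStack (n : ℕ) :
    TM2to1.addBottom (mainStack (trList [n])) = ListBlank.mk (tapeSymbol true .cons ::
      n.bits.reverse.map fun b => tapeSymbol false (bitSymbol b)) := by
  have e : (trList [n]).reverse = .cons :: n.bits.reverse.map bitSymbol := by
    simp [trList, trNat_eq_map_bits]
  have h (a) (l : List (∀ k : K', Option ((fun _ => Γ') k))) :
      TM2to1.addBottom (ListBlank.mk (a :: l)) =
        ListBlank.mk ((true, a) :: l.map fun x => (false, x)) := rfl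
  rw [mainStack, e, List.map_cons, h, List.map_map, List.map_map]
  rfl

/-- The number on the tape of the simulating machine with two symbols, when the main stack
contains the number `n`. -/
theorem blankNum_addBottom_mainStack {m : ℕ} {enc : TM2to1.Γ' K' (fun _ => Γ') → List.Vector Bool m}
    (h : ∃ k, (enc default).toList = List.replicate k default) (n : ℕ) :
    blankNum ((TM2to1.addBottom (mainStack (trList [n]))).flatMap (fun x => (enc x).toList) h) =
      digitCode (2 ^ m) (bitsNum (enc (tapeSymbol true .cons)).toList)
        (fun b => bitsNum (enc (tapeSymbol false (bitSymbol b))).toList) n := by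
  rw [addBottom_mainStack, ListBlank.flatMap_mk, blankNum_mk, bitsNum_flatMap _ m fun a => (enc a).toList_length,
    digitCode_eq_ofDigits, List.map_cons, List.map_map]
  rfl

end PartrecToTM2

open Turing.PartrecToTM2 CivBE.PartrecToTM2 in
/-- Every partial recursive function is computed by a machine with two numbers, the second one
holding argument and value in the same primitive recursive coding. -/
theorem exists_pairMachine_of_partrec {f : ℕ →. ℕ} (hf : Partrec f) :
    ∃ (σ : Type) (_ : Fintype σ) (_ : DecidableEq σ) (M : PairMachine σ) (q : σ) (E G : ℕ → ℕ),
      Primrec E ∧ Primrec G ∧ (∀ n, G (E n) = n) ∧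
      ∀ n, ((eval M.step (some q, 0, E n)).Dom ↔ (f n).Dom) ∧
        ∀ v ∈ f n, (none, 0, E v) ∈ eval M.step (some q, 0, E n) := by
  classical
  obtain ⟨c, hc⟩ := ToPartrec.Code.exists_code (Nat.Partrec'.part_iff₁.mpr hf)
  obtain ⟨m, enc, dec, enc0, encdec⟩ :=
    TM1to1.exists_enc_dec (Γ := TM2to1.Γ' K' (fun _ => Γ'))
  -- The default label is the start label in all the translations, so it must be the entry point of
  -- `c`.
  let : Inhabited Turing.PartrecToTM2.Λ' := ⟨Turing.PartrecToTM2.trNormal c .halt⟩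
  let M₂ := Turing.PartrecToTM2.tr
  let M₁ := TM2to1.tr M₂
  let M₁' := TM1to1.tr enc dec M₁
  let M₀ := TM1to0.tr M₁'
  let S := TM1to0.trStmts M₁' (TM1to1.trSupp M₁ (TM2to1.trSupp M₂ (codeSupp c .halt)))
  have hS : TM0.Supports M₀ (S : Set (TM1to0.Λ' M₁')) :=
    TM1to0.tr_supports _ (TM1to1.tr_supports _ _ _ (TM2to1.tr_supports _
      (Turing.PartrecToTM2.tr_supports c .halt)))
  let t (q : Option Turing.PartrecToTM2.Λ') (n : ℕ) : TM0.Cfg Bool (TM1to0.Λ' M₁') :=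
    TM1to0.trCfg M₁' (TM1to1.trCfg enc enc0
      ⟨q.map TM2to1.Λ'.normal, none, Tape.mk' ∅ (TM2to1.addBottom (mainStack (trList [n])))⟩)
  have hl (q n) : blankNum (t q n).Tape.left = 0 := by
    simp only [t, TM1to0.trCfg, TM1to1.trCfg, TM1to1.trTape_mk', TM1to1.trTape', Tape.mk'_left]
    rfl
  have hr (q n) : blankNum (t q n).Tape.right₀ = digitCode (2 ^ m)
      (bitsNum (enc (tapeSymbol true .cons)).toList)
      (fun b => bitsNum (enc (tapeSymbol false (bitSymbol b))).toList) n := by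
    simp only [t, TM1to0.trCfg, TM1to1.trCfg, TM1to1.trTape_mk', TM1to1.trTape', Tape.mk'_right₀]
    exact blankNum_addBottom_mainStack _ n
  have ht (n : ℕ) : (t (some default) n).q ∈ S := hS.1
  -- The blank is encoded by zeros only, and `enc` is injective with a fixed length.
  have hne (a) (ha : a ≠ default) : bitsNum (enc a).toList ≠ 0 := by
    have h0 : bitsNum (enc default).toList = 0 := by
      rw [enc0]
      exact bitsNum_append_replicate [] m
    intro h
    have := List.Vector.toList_injective (bitsNum_injOn (by simp) (h.trans h0.symm))
    exact ha (by rw [← encdec a, this, encdec])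
  have hlt (a) : bitsNum (enc a).toList < 2 ^ m := by
    simpa using bitsNum_lt (enc a).toList
  have hb (b) : bitsNum (enc (tapeSymbol false (bitSymbol b))).toList ≠ 0 :=
    hne _ fun h => by simpa [tapeSymbol, mainSymbol] using congrFun (congrArg Prod.snd h) K'.main
  have hinj : Function.Injective fun b =>
      bitsNum (enc (tapeSymbol false (bitSymbol b))).toList := by
    intro b b' h
    have h' := congrArg dec (List.Vector.toList_injective (bitsNum_injOn (by simp) h))
    rw [encdec, encdec] at h'
    have h'' : some (bitSymbol b) = some (bitSymbol b') := congrFun (congrArg Prod.snd h') K'.main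
    cases b <;> cases b' <;> first | rfl | cases h''
  obtain ⟨G, hG, hGE⟩ := exists_primrec_leftInverse_digitCode
    (hne (tapeSymbol true .cons) fun h => by cases congrArg Prod.fst h) (hlt _) hb
    (fun b => hlt _) hinj
  have h₁ (n : ℕ) : TM2to1.TrCfg (init c [n])
      ⟨some (TM2to1.Λ'.normal default), none,
        Tape.mk' ∅ (TM2to1.addBottom (mainStack (trList [n])))⟩ :=
    .mk (q := some default) _ (map_proj_mainStack _)
  refine ⟨_, inferInstance, inferInstance, TM0.pairMachine M₀ S, (⟨_, ht 0⟩, false), _, G,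
    primrec_digitCode _ _ _, hG, hGE, fun n => ⟨?_, fun v hv => ?_⟩⟩
  · have := TM0.pairMachine_eval_dom hS (ht n)
    rw [hl, hr] at this
    refine this.trans ?_
    rw [tr_eval_dom (TM1to0.tr_respects M₁') rfl,
      tr_eval_dom (TM1to1.tr_respects dec M₁ encdec) rfl]
    refine (tr_eval_dom (TM2to1.tr_respects M₂) (h₁ n)).trans ?_
    rw [Turing.PartrecToTM2.tr_eval]
    exact Eq.to_iff (congrArg Part.Dom (hc (n ::ᵥ List.Vector.nil)))
  · have hv' : Turing.PartrecToTM2.halt [v] ∈ eval (TM2.step M₂) (init c [n]) := by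
      rw [Turing.PartrecToTM2.tr_eval, show c.eval [n] = _ from hc (n ::ᵥ List.Vector.nil)]
      exact Part.mem_map _ (Part.mem_map _ hv)
    obtain ⟨d, hd, hd'⟩ := tr_eval (TM2to1.tr_respects M₂) (h₁ n) hv'
    cases hd with
    | mk L hL =>
    -- The halting tape has the shape of the initial one, so argument and value share one coding.
    obtain rfl := eq_mainStack hL
    obtain ⟨_, rfl, hd'⟩ := tr_eval (TM1to1.tr_respects dec M₁ encdec) rfl hd'
    obtain ⟨_, rfl, hd'⟩ := tr_eval (TM1to0.tr_respects M₁') rfl hd'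
    have := TM0.pairMachine_mem_eval (c' := t none v) hS (ht n) hd'
    rwa [hl, hr, hl, hr] at this

end CivBE

namespace CivBE

open StateTransition

/-! ### Configurations of arbitrary machines as finite objects -/

namespace Program

/-- The tape content `(l, r)` after writing `a` and moving to `d`. -/
def moveContent (a : ℕ) (d : Dir) (x : List ℕ × List ℕ) : List ℕ × List ℕ :=
  if d = .L then (x.1.tail, x.1.headI :: a :: x.2.tail) else (a :: x.1, x.2.tail)

/-- One step of a Turing machine on its state and its tape content; the machine is carried along. -/
def listStep (x : Program × ℕ × List ℕ × List ℕ) : Option (Program × ℕ × List ℕ × List ℕ) :=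
  (x.1.lookup (x.2.1, x.2.2.2.headI)).map fun y => (x.1, y.1, moveContent y.2.1 y.2.2 x.2.2)

theorem lookup_eq_foldr {α β : Type*} [BEq α] [LawfulBEq α] [DecidableEq α] (l : List (α × β)) (a : α) :
    l.lookup a = l.foldr (fun x y => if a = x.1 then some x.2 else y) none := by
  induction l with
  | nil => rfl
  | cons x l ih =>
    rw [List.lookup_cons, List.foldr_cons, ← ih]
    by_cases h : a = x.1
    · simp [h]
    · rw [if_neg h, beq_eq_false_iff_ne.mpr h]

theorem primrec_lookup {α β : Type*} [Primcodable α] [Primcodable β] [BEq α] [LawfulBEq α]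
    [DecidableEq α] :
    Primrec₂ fun (l : List (α × β)) (a : α) => l.lookup a := by
  have : Primrec₂ fun (l : List (α × β)) (a : α) =>
      l.foldr (fun x y => if a = x.1 then some x.2 else y) none := by
    refine Primrec.list_foldr (f := fun x : List (α × β) × α => x.1) (g := fun _ => none)
      (h := fun x y => if x.2 = y.1.1 then some y.1.2 else y.2) .fst (.const none) ?_
    refine Primrec.ite (Primrec.eq.comp (Primrec.snd.comp .fst)
      (Primrec.fst.comp (Primrec.fst.comp .snd))) ?_ (Primrec.snd.comp .snd)
    exact Primrec.option_some.comp (Primrec.snd.comp (Primrec.fst.comp .snd))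
  exact this.of_eq fun l a => (lookup_eq_foldr l a).symm

theorem primrec_moveContent :
    Primrec fun x : (ℕ × Dir) × List ℕ × List ℕ => moveContent x.1.1 x.1.2 x.2 := by
  have h₁ : Primrec fun x : (ℕ × Dir) × List ℕ × List ℕ => x.2.1 := Primrec.fst.comp .snd
  have h₂ : Primrec fun x : (ℕ × Dir) × List ℕ × List ℕ => x.2.2.tail :=
    Primrec.list_tail.comp (Primrec.snd.comp .snd)
  have h₃ : Primrec fun x : (ℕ × Dir) × List ℕ × List ℕ => x.1.1 := Primrec.fst.comp .fst
  refine Primrec.ite (Primrec.eq.comp (Primrec.snd.comp .fst) (.const _)) (.pair ?_ ?_)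
    (.pair ?_ h₂)
  · exact Primrec.list_tail.comp h₁
  · exact Primrec.list_cons.comp (Primrec.list_headI.comp h₁) (Primrec.list_cons.comp h₃ h₂)
  · exact Primrec.list_cons.comp h₃ h₁

theorem primrec_listStep : Primrec listStep := by
  refine Primrec.option_map (primrec_lookup.comp .fst (.pair (Primrec.fst.comp .snd)
    (Primrec.list_headI.comp (Primrec.snd.comp (Primrec.snd.comp .snd))))) ?_
  refine Primrec.pair (Primrec.fst.comp .fst) (.pair (Primrec.fst.comp .snd) ?_)
  exact primrec_moveContent.comp (.pair (Primrec.snd.comp .snd)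
    (Primrec.snd.comp (Primrec.snd.comp .fst)))

theorem partrec_eval_listStep : Partrec (eval listStep) := by
  refine Partrec.fix (f := fun s => Part.some ((listStep s).elim (Sum.inl s) Sum.inr)) ?_
  have : Computable fun s => ((listStep s).elim (Sum.inl s) Sum.inr :
      (Program × ℕ × List ℕ × List ℕ) ⊕ (Program × ℕ × List ℕ × List ℕ)) := by
    have h : Primrec fun s => (Option.casesOn (listStep s) (Sum.inl s) Sum.inr :
        (Program × ℕ × List ℕ × List ℕ) ⊕ (Program × ℕ × List ℕ × List ℕ)) :=
      Primrec.option_casesOn primrec_listStep Primrec.sumInl (Primrec.sumInr.comp .snd)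
    refine (h.of_eq fun s => ?_).to_comp
    cases listStep s <;> rfl
  exact this

/-- The finite object `x` describes the configuration `c` of the machine `p`. -/
def Describes (p : Program) (x : Program × ℕ × List ℕ × List ℕ) (c : Cfg ℕ ℕ) : Prop :=
  x.1 = p ∧ c.state = x.2.1 ∧ p.machine.HasContent c x.2.2

theorem hasContent_moveContent {p : Program} {q q' : ℕ} {i : ℤ} {t : ℤ → ℕ}
    {x : List ℕ × List ℕ} (h : p.machine.HasContent ⟨q, i, t⟩ x) (a : ℕ) (d : Dir) :
    p.machine.HasContent ⟨q', d.shift i, Function.update t i a⟩ (moveContent a d x) := by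
  obtain ⟨l, r⟩ := x
  intro n
  cases d
  · constructor
    · change Function.update t i a (i - 1 + n) = (l.headI :: a :: r.tail).getD n 0
      rcases n with _ | _ | n
      · rw [Function.update_of_ne (by omega)]
        have := (h 0).2
        cases l <;> simpa [machine] using this
      · rw [show i - 1 + ((0 + 1 : ℕ) : ℤ) = i by omega, Function.update_self]
        rfl
      · have := (h (n + 1)).1
        dsimp only at this
        rw [Function.update_of_ne (by omega),
          show i - 1 + ((n + 1 + 1 : ℕ) : ℤ) = i + (n + 1 : ℕ) by omega, this]
        cases r <;> rfl
    · change Function.update t i a (i - 1 - 1 - n) = l.tail.getD n 0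
      have := (h (n + 1)).2
      dsimp only at this
      rw [Function.update_of_ne (by omega),
        show i - 1 - 1 - (n : ℤ) = i - 1 - (n + 1 : ℕ) by omega, this]
      cases l <;> rfl
  · constructor
    · change Function.update t i a (i + 1 + n) = r.tail.getD n 0
      have := (h (n + 1)).1
      dsimp only at this
      rw [Function.update_of_ne (by omega),
        show i + 1 + (n : ℤ) = i + (n + 1 : ℕ) by omega, this]
      cases r <;> rfl
    · change Function.update t i a (i + 1 - 1 - n) = (a :: l).getD n 0
      rcases n with _ | n
      · rw [show i + 1 - 1 - ((0 : ℕ) : ℤ) = i by omega, Function.update_self]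
        rfl
      · have := (h n).2
        dsimp only at this
        rw [Function.update_of_ne (by omega),
          show i + 1 - 1 - ((n + 1 : ℕ) : ℤ) = i - 1 - n by omega, this]
        rfl

theorem describes_respects (p : Program) : Respects listStep p.machine.step p.Describes := by
  rintro ⟨p', q', l, r⟩ ⟨q, i, t⟩ ⟨hp, hq, hx⟩
  dsimp only at hp hq hx
  subst hp hq
  -- On an empty list `headI` gives `0`, which is the blank.
  have hi : t i = r.headI := by
    have := (hx 0).1
    cases r <;> simpa [machine] using this
  have hs : p'.machine.step ⟨q, i, t⟩ = (p'.lookup (q, r.headI)).map fun y =>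
      ⟨y.1, y.2.2.shift i, Function.update t i y.2.1⟩ := by
    rw [← hi]
    rfl
  cases e : p'.lookup (q, r.headI) with
  | none =>
    have : listStep (p', q, l, r) = none := by simp [listStep, e]
    rw [this]
    rw [e] at hs
    exact hs
  | some y =>
    have : listStep (p', q, l, r) = some (p', y.1, moveContent y.2.1 y.2.2 (l, r)) := by
      simp [listStep, e]
    rw [this]
    rw [e] at hs
    exact ⟨_, ⟨rfl, rfl, hasContent_moveContent hx _ _⟩, .single hs⟩

theorem describes_init (p : Program) (w : List ℕ) :
    p.Describes (p, 0, [], w) (p.machine.init ([], w)) := by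
  refine ⟨rfl, rfl, fun i => ⟨?_, ?_⟩⟩
  · simp [TuringMachine.init]
  · have : ¬ 0 ≤ (0 : ℤ) - 1 - i := by omega
    simp only [TuringMachine.init, if_neg this]
    rfl

/-- The function that maps the code of a machine and an input word to the code of the halting
configuration. -/
def haltingCfg (n : ℕ) : Part ℕ :=
  let x : Program × List ℕ := (Encodable.decode n).getD default
  (eval listStep (x.1, 0, [], x.2)).map fun y => Encodable.encode y.2

theorem partrec_haltingCfg : Partrec haltingCfg := by
  refine Partrec.map (partrec_eval_listStep.comp ?_) ?_
  · have : Primrec fun n : ℕ => ((Encodable.decode n).getD default : Program × List ℕ) :=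
      Primrec.option_getD.comp Primrec.decode (.const default)
    exact (Primrec.pair (Primrec.fst.comp this) (.pair (.const 0) (.pair (.const [])
      (Primrec.snd.comp this)))).to_comp
  · exact (Primrec.encode.comp (Primrec.snd.comp .snd)).to_comp

theorem haltingCfg_dom (p : Program) (w : List ℕ) :
    (haltingCfg (Encodable.encode (p, w))).Dom ↔
      ∃ c, p.machine.HaltsAt (p.machine.init ([], w)) c := by
  simp only [PairMachine.haltsAt_iff_mem_eval, ← Part.dom_iff_mem]
  rw [tr_eval_dom (describes_respects p) (describes_init p w)]
  simp [haltingCfg]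

theorem exists_mem_haltingCfg {p : Program} {w : List ℕ} {c : Cfg ℕ ℕ}
    (h : p.machine.HaltsAt (p.machine.init ([], w)) c) :
    ∃ x : ℕ × List ℕ × List ℕ, Encodable.encode x ∈ haltingCfg (Encodable.encode (p, w)) ∧
      c.state = x.1 ∧ p.machine.HasContent c x.2 := by
  rw [PairMachine.haltsAt_iff_mem_eval] at h
  obtain ⟨x, ⟨-, hx⟩, h'⟩ := tr_eval_rev (describes_respects p) (describes_init p w) h
  refine ⟨x.2, ?_, hx⟩
  simp only [haltingCfg, Encodable.encodek, Option.getD_some]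
  exact Part.mem_map (fun y : Program × ℕ × List ℕ × List ℕ => Encodable.encode y.2) h'

end Program

end CivBE

namespace CivBE

open StateTransition

/-! ### Universality -/

theorem primrec_dropLast {α : Type*} [Primcodable α] : Primrec (List.dropLast (α := α)) :=
  (Primrec.list_reverse.comp (Primrec.list_tail.comp Primrec.list_reverse)).of_eq fun l => by simp

theorem primrec_sepCount : Primrec sepCount := by
  refine Primrec.snd.comp (Primrec.list_foldl (h := fun _ x => countStep x.1 x.2) .id
    (.const (TileSymbol.noImprovement, 0)) ?_)
  have hb : ∀ {f : List TileSymbol × (TileSymbol × ℕ) × TileSymbol → TileSymbol}, Primrec f →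
      PrimrecPred fun x => f x = .pillagedRoad :=
    fun hf => Primrec.eq.comp hf (.const _)
  have h₁ : Primrec fun x : List TileSymbol × (TileSymbol × ℕ) × TileSymbol => x.2.1 :=
    Primrec.fst.comp .snd
  have h₂ : Primrec fun x : List TileSymbol × (TileSymbol × ℕ) × TileSymbol => x.2.2 :=
    Primrec.snd.comp .snd
  refine Primrec.pair h₂ (Primrec.ite ((hb (Primrec.fst.comp h₁)).and (hb h₂)) ?_ ?_)
  · exact Primrec.succ.comp (Primrec.snd.comp h₁)
  · exact Primrec.snd.comp h₁

theorem primrec_body_replicate {A : Type} (idx : A → ℕ) (a : A) :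
    Primrec fun n => body idx (List.replicate n a) := by
  have : Primrec fun n : ℕ => (body idx [a] ++ ·)^[n] [] :=
    Primrec.nat_iterate .id (.const _) (Primrec.list_append.comp (.const _) .snd)
  refine this.of_eq fun n => ?_
  induction n with
  | zero => rfl
  | succ n ih => rw [Function.iterate_succ_apply', ih, ← body_append]; rfl

/-- Only the number of `unitY` letters depends on the argument. The library and the numbering of
letters are constants, so their noncomputable definition does no harm. -/
theorem PairMachine.primrec_tape {σ : Type} [Fintype σ] [DecidableEq σ] (M : PairMachine σ)
    (q : σ) : Primrec (M.tape q) := by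
  refine Primrec.pair (.const _) ?_
  refine Primrec.list_cons.comp (.const _) (Primrec.list_cons.comp (.const _)
    (Primrec.list_append.comp (primrec_dropLast.comp (primrec_dropLast.comp ?_)) (.const _)))
  have : Primrec fun y => body (letterIdx (haltLetter (σ := σ)))
      [(.markX, some q, true), (.unitX, some q, true), (.markY, some q, true)] ++
        body (letterIdx haltLetter) (List.replicate y (.unitY, some q, true)) :=
    Primrec.list_append.comp (.const _) (primrec_body_replicate _ _)
  refine this.of_eq fun y => ?_
  rw [← body_append]
  rfl

theorem isUniversal_civMachine : IsUniversal civMachine := by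
  obtain ⟨σ, _, _, M, q, E, G, hE, hG, hGE, hM⟩ :=
    exists_pairMachine_of_partrec Program.partrec_haltingCfg
  refine ⟨fun x => M.tape q (E (Encodable.encode x)),
    -- The machine halts with numbers `(0, y)`, for which there are `2 * 0 + y + 2` separators.
    fun x => (Encodable.decode (G (sepCount x.2 - 2))).getD default,
    (M.primrec_tape q).comp (hE.comp Primrec.encode),
    Primrec.option_getD.comp (Primrec.decode.comp (hG.comp (Primrec.nat_sub.comp
      (primrec_sepCount.comp .snd) (.const 2)))) (.const default),
    fun p w => ⟨?_, fun c d hc hd x hx => ?_⟩⟩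
  · rw [M.halts_iff, (hM _).1, Program.haltingCfg_dom]
  · obtain ⟨y, hy, hy'⟩ := Program.exists_mem_haltingCfg hc
    have := M.sepCount_of_halts hd ((hM _).2 _ hy) hx
    dsimp only
    rw [this, mul_zero, zero_add, Nat.add_sub_cancel, hGE, Encodable.encodek]
    exact hy'

theorem isUTM_civMachine : IsUTM 10 3 civMachine :=
  ⟨by simp, by simp [Nat.card_congr TileSymbol.equivFin], isUniversal_civMachine⟩

theorem rogozhin_δ (q : Fin 10) (a : TileSymbol) :
    rogozhin.δ q (TileSymbol.equivRSymbol a) =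
      (civMachine.δ q a).map fun x => (x.1, TileSymbol.equivRSymbol x.2.1, x.2.2) := by
  cases a <;> fin_cases q <;> rfl

end CivBE

namespace CivBE

/-! ### Plays -/

theorem Play.append {W : World} {s₁ s₂ s₃ : GameState} {os os' : List Orders}
    (h : Play W s₁ os s₂) (h' : Play W s₂ os' s₃) : Play W s₁ (os ++ os') s₃ := by
  induction h with
  | nil => exact h'
  | cons h _ ih => exact .cons h (ih h')

theorem Play.single {W : World} {s s' : GameState} {o : Orders} (h : Turn W s o s') :
    Play W s [o] s' :=
  .cons h (.nil _)

/-- The state `s'` can be reached from `s` by orders that satisfy `P`, within `a` turns, of which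
at most `b` are turns of work. -/
def CanReach (W : World) (P : Orders → Prop) (a b : ℕ) (s s' : GameState) : Prop :=
  ∃ os : List Orders, (∀ o ∈ os, P o) ∧ Play W s os s' ∧ os.length ≤ a ∧
    (os.filter Orders.isWork).length ≤ b

namespace CanReach

variable {W : World} {P Q : Orders → Prop} {a a' b b' : ℕ} {s s₁ s' : GameState}

theorem refl (s : GameState) : CanReach W P 0 0 s s := ⟨[], by simp, .nil _, by simp, by simp⟩

theorem trans (h : CanReach W P a b s s₁) (h' : CanReach W P a' b' s₁ s') :
    CanReach W P (a + a') (b + b') s s' := by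
  obtain ⟨os, h₁, h₂, h₃, h₄⟩ := h
  obtain ⟨os', h₁', h₂', h₃', h₄'⟩ := h'
  refine ⟨os ++ os', fun o ho => ?_, h₂.append h₂', ?_, ?_⟩
  · exact (List.mem_append.mp ho).elim (h₁ o) (h₁' o)
  · rw [List.length_append]
    omega
  · rw [List.filter_append, List.length_append]
    omega

theorem mono (h : CanReach W P a b s s') (hP : ∀ o, P o → Q o) (ha : a ≤ a') (hb : b ≤ b') :
    CanReach W Q a' b' s s' := by
  obtain ⟨os, h₁, h₂, h₃, h₄⟩ := h
  exact ⟨os, fun o ho => hP o (h₁ o ho), h₂, h₃.trans ha, h₄.trans hb⟩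

theorem of_turn {o : Orders} (hP : P o) (h : Turn W s o s') : CanReach W P 1 1 s s' :=
  ⟨[o], by simpa using hP, .single h, by simp, List.length_filter_le _ _⟩

theorem of_move {o : Orders} (hP : P o) (ho : o.isWork = false) (h : Turn W s o s') :
    CanReach W P 1 0 s s' :=
  ⟨[o], by simpa using hP, .single h, by simp, by simp [ho]⟩

/-- A Worker on tile `t` completes a building project. -/
theorem build {t : Tile} {k : Build} {o : Orders} (hP : P o)
    (ho : ∀ B B', Works W t (.build k) B B' → Turn W { s with board := B } o { s with board := B' })
    (hpos : 1 ≤ W.turns k) (B : Board) (hB : W.CanBuild B t k) :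
    ∃ B', CanReach W P (W.turns k) (W.turns k) { s with board := B } { s with board := B' } ∧
      B'.improvement = Function.update B.improvement t k.result := by
  -- Work may have been left over from earlier, so the remaining turns are only bounded.
  suffices ∀ n, ∀ B : Board, W.CanBuild B t k → W.turns k ≤ B.progress t k + n + 1 →
      ∃ B', CanReach W P (n + 1) (n + 1) { s with board := B } { s with board := B' } ∧
        B'.improvement = Function.update B.improvement t k.result by
    obtain ⟨B', h, h'⟩ := this (W.turns k - 1) B hB (by omega)
    rw [Nat.sub_add_cancel hpos] at h
    exact ⟨B', h, h'⟩
  intro n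
  induction n with
  | zero =>
    intro B hB hn
    exact ⟨_, .of_turn hP (ho _ _ (.finish B k hB hn)), rfl⟩
  | succ n ih =>
    intro B hB hn
    by_cases h : B.progress t k + 1 < W.turns k
    · have hB' : W.CanBuild (B.setProgress t k (B.progress t k + 1)) t k := by cases k <;> exact hB
      obtain ⟨B', h₁, h₂⟩ := ih _ hB' (by simp [Board.setProgress]; omega)
      refine ⟨B', ?_, h₂⟩
      rw [add_comm (n + 1)]
      exact (of_turn hP (ho _ _ (.goOn B k hB h))).trans h₁
    · exact ⟨_, (of_turn hP (ho _ _ (.finish B k hB (by omega)))).mono (fun _ h => h) (by omega)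
        (by omega), rfl⟩

end CanReach

/-! ### Game states that represent configurations -/

open Classical in
/-- The tiles of the state section with a Terrascape. -/
noncomputable def World.terrascapes (W : World) (B : Board) : Finset Tile :=
  {t ∈ W.stateSection ∩ W.worked | B.improvement t = .terrascape}

/-- The game state `s` has `n` Terrascapes, the symbols `τ` on the strip, and the head on
tile `i` of it. -/
structure Holds (W : World) (s : GameState) (n : ℕ) (τ : ℤ → TileSymbol) (i : ℤ) : Prop where
  card_eq : (W.terrascapes s.board).card = n
  tape_eq : ∀ i, s.board.improvement (W.strip i) = (τ i).improvement
  tapeWorker_eq : s.tapeWorker = W.strip i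
  rover_eq : s.rover = W.strip i
  stateWorker_mem : s.stateWorker ∈ W.stateSection
  terrascape_mem : ∀ t, s.board.improvement t = .terrascape → t ∈ W.stateSection ∩ W.worked
  stateTile : ∀ t ∈ W.stateSection ∩ W.worked,
    s.board.improvement t = .none ∨ s.board.improvement t = .terrascape

variable {W : World} {s : GameState} {n : ℕ} {τ : ℤ → TileSymbol} {i : ℤ}

/-- All Terrascapes stand on worked desert tiles and have the same yield, which Ecoscaping makes
nonzero. -/
theorem normalizedCulture_eq (hW : W.Suitable)
    (h : ∀ t, s.board.improvement t = .terrascape → t ∈ W.stateSection ∩ W.worked) :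
    W.normalizedCulture s = ((W.terrascapes s.board).card : ℚ) := by
  have hu : W.terrascapeYield .desert ≠ 0 := by simp [World.terrascapeYield, hW.has_ecoscaping]
  have hsum : (∑ t ∈ W.worked, if s.board.improvement t = .terrascape then
      W.terrascapeYield (W.terrain t) else 0) =
      (W.terrascapes s.board).card * W.terrascapeYield .desert := by
    classical
    rw [← Finset.sum_filter, ← smul_eq_mul, ← Finset.sum_const]
    refine Finset.sum_congr ?_ fun t ht => ?_
    · ext t
      simp only [World.terrascapes, Finset.mem_filter, Finset.mem_inter]
      constructor
      · rintro ⟨ht, h'⟩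
        exact ⟨Finset.mem_inter.mp (h t h'), h'⟩
      · rintro ⟨⟨-, ht⟩, h'⟩
        exact ⟨ht, h'⟩
    · rw [hW.section_desert t (Finset.mem_inter.mp (h t (Finset.mem_filter.mp ht).2)).1]
  rw [World.normalizedCulture, World.culture, hsum]
  push_cast
  rw [add_sub_cancel_left, mul_div_cancel_right₀ _ (by exact_mod_cast hu)]

theorem Represents.holds (hW : W.Suitable) {c : Cfg (Fin 10) TileSymbol} (h : Represents W s c) :
    Holds W s c.state.val c.tape c.head where
  card_eq := by
    have := h.state_eq
    rw [normalizedCulture_eq hW h.terrascape_mem] at this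
    exact_mod_cast this
  tape_eq := h.tape_eq
  tapeWorker_eq := h.tapeWorker_eq
  rover_eq := h.rover_eq
  stateWorker_mem := h.stateWorker_mem
  terrascape_mem := h.terrascape_mem
  stateTile := h.stateTile

namespace Holds

theorem represents (hW : W.Suitable) {q : Fin 10} (h : Holds W s q.val τ i) :
    Represents W s ⟨q, i, τ⟩ where
  state_eq := by rw [normalizedCulture_eq hW h.terrascape_mem, h.card_eq]
  tape_eq := h.tape_eq
  tapeWorker_eq := h.tapeWorker_eq
  rover_eq := h.rover_eq
  stateWorker_mem := h.stateWorker_mem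
  terrascape_mem := h.terrascape_mem
  stateTile := h.stateTile

/-- Change of the tile under the head. -/
theorem write (hW : W.Suitable) (h : Holds W s n τ i) {B : Board} {a : TileSymbol}
    (hB : B.improvement = Function.update s.board.improvement (W.strip i) a.improvement) :
    Holds W { s with board := B } n (Function.update τ i a) i := by
  have hne : ∀ t ∈ W.stateSection, B.improvement t = s.board.improvement t := by
    intro t ht
    rw [hB, Function.update_of_ne]
    rintro rfl
    exact hW.section_disjoint i ht
  have ha : a.improvement ≠ .terrascape := by cases a <;> simp [TileSymbol.improvement]
  refine ⟨?_, fun j => ?_, h.tapeWorker_eq, h.rover_eq, h.stateWorker_mem, fun t ht => ?_,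
    fun t ht => ?_⟩
  · rw [← h.card_eq]
    congr 1
    refine Finset.filter_congr fun t ht => ?_
    rw [hne t (Finset.mem_inter.mp ht).1]
  · rcases eq_or_ne j i with rfl | hj
    · simp [hB]
    · simp only [hB]
      rw [Function.update_of_ne (hW.strip_injective.ne hj), Function.update_of_ne hj, h.tape_eq]
  · dsimp only at ht
    rw [hB] at ht
    rcases eq_or_ne t (W.strip i) with rfl | hj
    · rw [Function.update_self] at ht
      exact absurd ht ha
    · rw [Function.update_of_ne hj] at ht
      exact h.terrascape_mem t ht
  · dsimp only
    rw [hne t (Finset.mem_inter.mp ht).1]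
    exact h.stateTile t ht

theorem setState (hW : W.Suitable) (h : Holds W s n τ i) {B : Board} {a : Improvement} {t : Tile}
    (ht : t ∈ W.stateSection ∩ W.worked) (ha : a = .none ∨ a = .terrascape)
    (hB : B.improvement = Function.update s.board.improvement t a) :
    Holds W { s with board := B } (W.terrascapes B).card τ i := by
  refine ⟨rfl, fun j => ?_, h.tapeWorker_eq, h.rover_eq, h.stateWorker_mem, fun u hu => ?_,
    fun u hu => ?_⟩
  · dsimp only
    rw [hB, Function.update_of_ne, h.tape_eq]
    rintro rfl
    exact hW.section_disjoint j (Finset.mem_inter.mp ht).1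
  · dsimp only at hu
    rcases eq_or_ne u t with rfl | hne
    · exact ht
    · rw [hB, Function.update_of_ne hne] at hu
      exact h.terrascape_mem u hu
  · dsimp only
    rcases eq_or_ne u t with rfl | hne
    · rwa [hB, Function.update_self]
    · rw [hB, Function.update_of_ne hne]
      exact h.stateTile u hu

theorem addTerrascape (hW : W.Suitable) (h : Holds W s n τ i) {B : Board} {t : Tile}
    (ht : t ∈ W.stateSection ∩ W.worked) (hn : s.board.improvement t = .none)
    (hB : B.improvement = Function.update s.board.improvement t .terrascape) :
    Holds W { s with board := B } (n + 1) τ i := by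
  classical
  have hc : (W.terrascapes B).card = n + 1 := by
    rw [← h.card_eq, ← Finset.card_insert_of_notMem (a := t) (by simp [World.terrascapes, hn])]
    congr 1
    ext u
    simp only [World.terrascapes, Finset.mem_filter, Finset.mem_insert, hB]
    rcases eq_or_ne u t with rfl | hne
    · simp [Finset.mem_inter.mp ht]
    · simp [hne]
  rw [← hc]
  exact h.setState hW ht (.inr rfl) hB

theorem removeTerrascape (hW : W.Suitable) (h : Holds W s (n + 1) τ i) {B : Board} {t : Tile}
    (hn : s.board.improvement t = .terrascape)
    (hB : B.improvement = Function.update s.board.improvement t .none) :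
    Holds W { s with board := B } n τ i := by
  classical
  have ht := h.terrascape_mem t hn
  have hc : (W.terrascapes B).card = n := by
    have : W.terrascapes B = (W.terrascapes s.board).erase t := by
      ext u
      simp only [World.terrascapes, Finset.mem_filter, Finset.mem_erase, hB]
      rcases eq_or_ne u t with rfl | hne
      · simp
      · simp [hne]
    rw [this, Finset.card_erase_of_mem (by simp [World.terrascapes, hn, Finset.mem_inter.mp ht]),
      h.card_eq, Nat.add_sub_cancel]
  rw [← hc]
  exact h.setState hW ht (.inl rfl) hB

theorem stateWorker_ne (hW : W.Suitable) (h : Holds W s n τ i) : s.stateWorker ≠ s.tapeWorker := by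
  intro e
  have := h.stateWorker_mem
  rw [e, h.tapeWorker_eq] at this
  exact hW.section_disjoint i this

end Holds

end CivBE

namespace CivBE

/-! ### Execution of commands -/

variable {W : World} {s : GameState} {n : ℕ} {τ : ℤ → TileSymbol} {i : ℤ}

theorem turn_tapeWorker {j : Job} {B : Board} (h : s.stateWorker ≠ s.tapeWorker)
    (hB : Works W s.tapeWorker j s.board B) :
    Turn W s ⟨.idle, j, false⟩ { s with board := B } :=
  ⟨.inl rfl, .inl rfl, .inl rfl, h, _, _, .idle _, hB, .idle _⟩

theorem turn_stateWorker {j : Job} {B : Board} (h : s.stateWorker ≠ s.tapeWorker)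
    (hB : Works W s.stateWorker j s.board B) :
    Turn W s ⟨j, .idle, false⟩ { s with board := B } :=
  ⟨.inl rfl, .inl rfl, .inl rfl, h, _, _, .idle _, .idle _, hB⟩

theorem turn_rover (h : s.stateWorker ≠ s.tapeWorker) (hs : s.board.improvement s.rover = .road) :
    Turn W s ⟨.idle, .idle, true⟩ { s with board := s.board.set s.rover .pillagedRoad } :=
  ⟨.inl rfl, .inl rfl, .inl rfl, h, _, _, .pillage _ hs, .idle _, .idle _⟩

theorem Adjacent.symm {t t' : Tile} (h : Adjacent t t') : Adjacent t' t := by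
  simp only [Adjacent, Set.mem_insert_iff, Set.mem_singleton_iff, Prod.mk.injEq] at h ⊢
  omega

theorem World.Suitable.strip_canMove (hW : W.Suitable) (d : Dir) (i : ℤ) :
    W.CanMove (W.strip i) (W.strip (d.shift i)) := by
  refine .inr ⟨?_, hW.strip_traversable _⟩
  cases d
  · have := hW.strip_adjacent (i - 1)
    rw [sub_add_cancel] at this
    exact this.symm
  · exact hW.strip_adjacent i

theorem Command.permits_idle (k : Command) : k.Permits ⟨.idle, .idle, false⟩ := by
  obtain ⟨t, d, u⟩ := k
  constructor
  · cases t <;> simp [TapeCommand.Permits]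
  · cases u <;> simp [StateCommand.Permits]

/-- The head moves. -/
theorem Holds.move (hW : W.Suitable) (h : Holds W s n τ i) (k : Command) (d : Dir) :
    ∃ s', CanReach W k.Permits 1 0 s s' ∧ Holds W s' n τ (d.shift i) := by
  refine ⟨{ s with tapeWorker := W.strip (d.shift i), rover := W.strip (d.shift i) },
    .of_move k.permits_idle rfl ⟨.inl rfl, ?_, ?_, ?_, _, _, .idle _, .idle _, .idle _⟩,
    ⟨h.card_eq, h.tape_eq, rfl, rfl, h.stateWorker_mem, h.terrascape_mem, h.stateTile⟩⟩
  · rw [h.tapeWorker_eq]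
    exact hW.strip_canMove d i
  · rw [h.rover_eq]
    exact hW.strip_canMove d i
  · intro e
    dsimp only at e
    exact hW.section_disjoint (d.shift i) (e ▸ h.stateWorker_mem)

/-- `m` depends only on the path, not on the game state or the command, as a uniform bound requires.
-/
theorem canReach_stateWorker {t t' : Tile} (hW : W.Suitable)
    (h : Relation.ReflTransGen (fun u v => Adjacent u v ∧ v ∈ W.stateSection) t t') :
    ∃ m, ∀ (s : GameState) (k : Command), s.stateWorker = t → s.tapeWorker ∉ W.stateSection →
      CanReach W k.Permits m 0 s { s with stateWorker := t' } := by
  induction h with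
  | refl =>
    refine ⟨0, fun s k hs _ => ?_⟩
    rw [← hs]
    exact .refl s
  | @tail u v _ huv ih =>
    obtain ⟨m, hm⟩ := ih
    refine ⟨m + 1, fun s k hs hs' => (hm s k hs hs').trans (b' := 0) (.of_move k.permits_idle rfl
      ⟨.inr ⟨huv.1, hW.section_traversable v huv.2⟩, .inl rfl, .inl rfl, ?_,
        _, _, .idle _, .idle _, .idle _⟩)⟩
    intro e
    exact hs' (e ▸ huv.2)

/-- The state Worker can always reach every tile of the state section within `m` turns. -/
def WalkBound (W : World) (m : ℕ) : Prop :=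
  ∀ ⦃s : GameState⦄ ⦃n : ℕ⦄ ⦃τ : ℤ → TileSymbol⦄ ⦃i : ℤ⦄, Holds W s n τ i →
    ∀ (k : Command), ∀ t ∈ W.stateSection,
      CanReach W k.Permits m 0 s { s with stateWorker := t }

theorem exists_walkBound (hW : W.Suitable) : ∃ m, WalkBound W m := by
  choose! f hf using fun (t : Tile) (ht : t ∈ W.stateSection) (t' : Tile)
    (ht' : t' ∈ W.stateSection) => canReach_stateWorker hW (hW.section_connected t ht t' ht')
  refine ⟨(W.stateSection ×ˢ W.stateSection).sup fun x => f x.1 x.2, fun s n τ i h k t ht => ?_⟩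
  refine (hf _ h.stateWorker_mem t ht s k rfl ?_).mono (fun _ h => h) ?_ le_rfl
  · rw [h.tapeWorker_eq]
    exact hW.section_disjoint i
  · exact Finset.le_sup (f := fun x : Tile × Tile => f x.1 x.2)
      (Finset.mk_mem_product h.stateWorker_mem ht)

/-- The tape command can be executed where the head reads `a`. -/
def TapeCommand.Fits : TapeCommand → TileSymbol → Prop
  | .leave, _ => True
  | .buildRoad, a => a = .noImprovement
  | .buildRoadAndPillage, a => a = .noImprovement
  | .pillageRoad, a => a = .road
  | .repairRoad, a => a = .pillagedRoad
  | .removeImprovement, a => a ≠ .noImprovement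

/-- The number of turns that the tape command takes. -/
def TapeCommand.cost (M : ℕ) : TapeCommand → ℕ
  | .leave => 0
  | .buildRoad => M
  | .buildRoadAndPillage => M + 1
  | .pillageRoad => 1
  | .repairRoad => 1
  | .removeImprovement => 1

/-- The state command can be executed in state `q`. -/
def StateCommand.Fits : StateCommand → ℕ → Prop
  | .noBuild, _ => True
  | .build n, q => q + n ≤ 9 ∧ n ≤ 5
  | .remove n, q => n ≤ q ∧ n ≤ 5

/-- The number of turns of work for the state command. -/
def StateCommand.cost (T : ℕ) : StateCommand → ℕ
  | .noBuild => 0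
  | .build n => n * T
  | .remove n => n

theorem StateCommand.permits_idle (k : StateCommand) : k.Permits .idle := by
  cases k <;> simp [StateCommand.Permits]

theorem TapeCommand.permits_idle (k : TapeCommand) : k.Permits .idle false := by
  cases k <;> simp [TapeCommand.Permits]

theorem Holds.buildRoad (hW : W.Suitable) (h : Holds W s n τ i) (ha : τ i = .noImprovement)
    {P : Orders → Prop} (hP : P ⟨.idle, .build .road, false⟩) :
    ∃ s', CanReach W P W.roadTurns W.roadTurns s s' ∧
      Holds W s' n (Function.update τ i .road) i := by
  have hB : W.CanBuild s.board s.tapeWorker .road := by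
    change s.board.improvement s.tapeWorker = .none
    rw [h.tapeWorker_eq, h.tape_eq, ha]
    rfl
  have hne := h.stateWorker_ne hW
  obtain ⟨B, h₁, h₂⟩ := CanReach.build (W := W) (s := s) (t := s.tapeWorker) (P := P) hP
    (fun B B' => turn_tapeWorker (s := { s with board := B }) hne)
    hW.roadTurns_pos s.board hB
  refine ⟨_, h₁, h.write hW ?_⟩
  rw [h₂, h.tapeWorker_eq]
  rfl

theorem Holds.pillageRoad (hW : W.Suitable) (h : Holds W s n τ i) (ha : τ i = .road)
    {P : Orders → Prop} (hP : P ⟨.idle, .idle, true⟩) :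
    ∃ s', CanReach W P 1 1 s s' ∧ Holds W s' n (Function.update τ i .pillagedRoad) i := by
  have hs : s.board.improvement s.rover = .road := by
    rw [h.rover_eq, h.tape_eq, ha]
    rfl
  refine ⟨_, .of_turn hP (turn_rover (h.stateWorker_ne hW) hs), h.write hW ?_⟩
  rw [h.rover_eq]
  rfl

/-- The tape Worker and the Rover execute a tape command. -/
theorem Holds.tapeCommand (hW : W.Suitable) (h : Holds W s n τ i) (k : Command)
    (hk : k.tape.Fits (τ i)) :
    ∃ s', CanReach W k.Permits (k.tape.cost W.roadTurns) (k.tape.cost W.roadTurns) s s' ∧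
      Holds W s' n (Function.update τ i (k.tape.write (τ i))) i := by
  obtain ⟨t, d, u⟩ := k
  have hu := u.permits_idle
  have hne := h.stateWorker_ne hW
  have hs : s.board.improvement s.tapeWorker = (τ i).improvement := by
    rw [h.tapeWorker_eq, h.tape_eq]
  cases t with
  | leave =>
    refine ⟨s, .refl s, ?_⟩
    simpa [TapeCommand.write] using h
  | buildRoad => exact h.buildRoad hW hk ⟨by simp [TapeCommand.Permits], hu⟩
  | buildRoadAndPillage =>
    obtain ⟨s₁, h₁, h₁'⟩ := h.buildRoad hW hk (P := Command.Permits ⟨.buildRoadAndPillage, d, u⟩)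
      ⟨by simp [TapeCommand.Permits], hu⟩
    obtain ⟨s₂, h₂, h₂'⟩ := h₁'.pillageRoad hW (by simp)
      (P := Command.Permits ⟨.buildRoadAndPillage, d, u⟩) ⟨by simp [TapeCommand.Permits], hu⟩
    refine ⟨s₂, h₁.trans h₂, ?_⟩
    simpa [TapeCommand.write] using h₂'
  | pillageRoad => exact h.pillageRoad hW hk ⟨by simp [TapeCommand.Permits], hu⟩
  | repairRoad =>
    have hk' : τ i = .pillagedRoad := hk
    refine ⟨_, .of_turn (o := ⟨.idle, .repair, false⟩) ⟨by simp [TapeCommand.Permits], hu⟩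
      (turn_tapeWorker hne (.repair _ ?_)), h.write hW ?_⟩
    · rw [hs, hk']
      rfl
    · rw [h.tapeWorker_eq]
      rfl
  | removeImprovement =>
    refine ⟨_, .of_turn (o := ⟨.idle, .remove, false⟩) ⟨by simp [TapeCommand.Permits], hu⟩
      (turn_tapeWorker hne (.remove _ ?_)), h.write hW ?_⟩
    · rw [hs]
      have hk' : τ i ≠ .noImprovement := hk
      cases e : τ i <;> simp_all [TileSymbol.improvement]
    · rw [h.tapeWorker_eq]
      rfl

theorem Holds.walk (h : Holds W s n τ i) {t : Tile} (ht : t ∈ W.stateSection) :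
    Holds W { s with stateWorker := t } n τ i :=
  ⟨h.card_eq, h.tape_eq, h.tapeWorker_eq, h.rover_eq, ht, h.terrascape_mem, h.stateTile⟩

/-- The state Worker builds a Terrascape. -/
theorem Holds.build (hW : W.Suitable) (h : Holds W s n τ i) (hn : n < 9) {m : ℕ} (hm : WalkBound W m)
    {k : Command} (hk : k.state.Permits (.build .terrascape)) :
    ∃ s', CanReach W k.Permits (m + W.terrascapeTurns) W.terrascapeTurns s s' ∧
      Holds W s' (n + 1) τ i := by
  obtain ⟨t, ht, htn⟩ : ∃ t ∈ W.stateSection ∩ W.worked, t ∉ W.terrascapes s.board :=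
    Finset.exists_mem_notMem_of_card_lt_card
      (by rw [h.card_eq]; exact hn.trans_le hW.nine_worked)
  have htile : s.board.improvement t = .none :=
    (h.stateTile t ht).resolve_right fun e => htn (by simp [World.terrascapes, ht, e])
  have hts := (Finset.mem_inter.mp ht).1
  have h' := h.walk hts
  have hB : W.CanBuild s.board t .terrascape := by
    refine ⟨htile, hW.section_owned t hts, hW.has_terraforming, ?_⟩
    have : {u | s.board.improvement u = .terrascape} = (W.terrascapes s.board : Set Tile) := by
      ext u
      simp only [World.terrascapes, Set.mem_ofPred_eq, Finset.coe_filter]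
      exact ⟨fun e => ⟨h.terrascape_mem u e, e⟩, fun e => e.2⟩
    rw [this, Set.encard_coe_eq_coe_finsetCard, h.card_eq]
    exact_mod_cast hn.trans_le hW.nine_maintainable
  have hne := h'.stateWorker_ne hW
  obtain ⟨B, h₁, h₂⟩ := CanReach.build (W := W) (s := { s with stateWorker := t }) (t := t)
    (P := k.Permits) (o := ⟨.build .terrascape, .idle, false⟩) ⟨k.tape.permits_idle, hk⟩
    (fun B B' => turn_stateWorker (s := { s with stateWorker := t, board := B }) hne)
    hW.terrascapeTurns_pos s.board hB
  exact ⟨_, ((hm h k t hts).trans h₁).mono (fun _ h => h) le_rfl (zero_add _).le,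
    h'.addTerrascape hW ht htile h₂⟩

/-- The state Worker removes a Terrascape. -/
theorem Holds.remove (hW : W.Suitable) (h : Holds W s (n + 1) τ i) {m : ℕ} (hm : WalkBound W m)
    {k : Command} (hk : k.state.Permits .remove) :
    ∃ s', CanReach W k.Permits (m + 1) 1 s s' ∧ Holds W s' n τ i := by
  obtain ⟨t, ht⟩ : (W.terrascapes s.board).Nonempty := by
    rw [← Finset.card_pos, h.card_eq]
    omega
  obtain ⟨ht, htn⟩ := Finset.mem_filter.mp ht
  have hts := (Finset.mem_inter.mp ht).1
  have h' := h.walk hts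
  refine ⟨_, ((hm h k t hts).trans (.of_turn (o := ⟨.remove, .idle, false⟩) ⟨k.tape.permits_idle, hk⟩
    (turn_stateWorker (h'.stateWorker_ne hW) (.remove _ ?_)))).mono (fun _ h => h) le_rfl le_rfl,
    h'.removeTerrascape hW (t := t) htn rfl⟩
  dsimp only
  rw [htn]
  simp

theorem Holds.builds (hW : W.Suitable) (h : Holds W s n τ i) {m : ℕ} (hm : WalkBound W m)
    {k : Command} (hk : k.state.Permits (.build .terrascape)) (r : ℕ) (hr : n + r ≤ 9) :
    ∃ s', CanReach W k.Permits (r * (m + W.terrascapeTurns)) (r * W.terrascapeTurns) s s' ∧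
      Holds W s' (n + r) τ i := by
  induction r with
  | zero => exact ⟨s, by simpa using CanReach.refl s, h⟩
  | succ r ih =>
    obtain ⟨s₁, h₁, h₁'⟩ := ih (by omega)
    obtain ⟨s₂, h₂, h₂'⟩ := h₁'.build hW (by omega) hm hk
    rw [add_one_mul, add_one_mul]
    exact ⟨s₂, h₁.trans h₂, h₂'⟩

theorem Holds.removes (hW : W.Suitable) {m : ℕ} (hm : WalkBound W m) {k : Command}
    (hk : k.state.Permits .remove) (r : ℕ) (h : Holds W s (n + r) τ i) :
    ∃ s', CanReach W k.Permits (r * (m + 1)) r s s' ∧ Holds W s' n τ i := by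
  induction r generalizing s with
  | zero => exact ⟨s, by simpa using CanReach.refl s, h⟩
  | succ r ih =>
    obtain ⟨s₁, h₁, h₁'⟩ := Holds.remove hW h hm hk
    obtain ⟨s₂, h₂, hs₂⟩ := ih h₁'
    rw [add_one_mul, add_comm, add_comm r]
    exact ⟨s₂, h₁.trans h₂, hs₂⟩

/-- The state Worker executes a state command. -/
theorem Holds.stateCommand (hW : W.Suitable) {m : ℕ} (hm : WalkBound W m) (k : Command) {q : Fin 10}
    (h : Holds W s q.val τ i) (hk : k.state.Fits q.val) :
    ∃ s', CanReach W k.Permits (5 * (m + W.terrascapeTurns)) (k.state.cost W.terrascapeTurns) s s' ∧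
      Holds W s' (k.state.apply q).val τ i := by
  obtain ⟨t, d, u⟩ := k
  have hT := hW.terrascapeTurns_pos
  cases u with
  | noBuild => exact ⟨s, (CanReach.refl s).mono (fun _ h => h) (by simp) le_rfl, h⟩
  | build r =>
    obtain ⟨hr, hr'⟩ : q.val + r ≤ 9 ∧ r ≤ 5 := hk
    obtain ⟨s', h₁, h₂⟩ := h.builds hW hm (k := ⟨t, d, .build r⟩) (.inr rfl) r hr
    refine ⟨s', h₁.mono (fun _ h => h) (Nat.mul_le_mul_right _ hr') le_rfl, ?_⟩
    simpa [StateCommand.apply, Nat.mod_eq_of_lt (show q.val + r < 10 by omega)] using h₂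
  | remove r =>
    obtain ⟨hr, hr'⟩ : r ≤ q.val ∧ r ≤ 5 := hk
    obtain ⟨s', h₁, h₂⟩ := Holds.removes hW hm (k := ⟨t, d, .remove r⟩) (n := q.val - r) (.inr rfl) r
      (by rwa [Nat.sub_add_cancel hr])
    refine ⟨s', h₁.mono (fun _ h => h) (Nat.mul_le_mul hr' (by omega)) le_rfl, ?_⟩
    simpa [StateCommand.apply, Nat.mod_eq_of_lt (show q.val - r < 10 by omega)] using h₂

/-- In particular, neither the reduction modulo ten nor the truncated subtraction in
`StateCommand.apply` ever takes effect. -/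
theorem table_fits {q : Fin 10} {a : TileSymbol} {k : Command} (h : table q a = some k) :
    k.tape.Fits a ∧ k.state.Fits q.val := by
  cases a <;> fin_cases q <;> cases h <;> simp [TapeCommand.Fits, StateCommand.Fits]

/-- At most three Terrascapes are built in an entry; up to five are removed, at one turn each. The
only tape command of cost `M + 1` comes with two removals. -/
theorem table_cost {q : Fin 10} {a : TileSymbol} {k : Command} (h : table q a = some k) {M T : ℕ}
    (hM : 1 ≤ M) (hT : 1 ≤ T) : k.tape.cost M + k.state.cost T ≤ 5 * T + M := by
  cases a <;> fin_cases q <;> cases h <;> simp only [TapeCommand.cost, StateCommand.cost] <;> omega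

/-- The game executes every step of the machine of the command table. -/
theorem exists_play_of_step (hW : W.Suitable) :
    ∃ K : ℕ, ∀ (s : GameState) (c c' : Cfg (Fin 10) TileSymbol),
      Represents W s c → civMachine.step c = some c' →
      ∃ (k : Command) (os : List Orders) (s' : GameState),
        table c.state (c.tape c.head) = some k ∧ (∀ o ∈ os, k.Permits o) ∧
        Play W s os s' ∧ Represents W s' c' ∧ os.length ≤ K ∧
        (os.filter Orders.isWork).length ≤ 5 * W.terrascapeTurns + W.roadTurns := by
  obtain ⟨m, hm⟩ := exists_walkBound hW
  -- At most `M + 1` turns for the tape command, one for the move of the head, and up to five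
  -- changes of Terrascapes, each with a walk of at most `m` turns.
  refine ⟨W.roadTurns + 1 + 1 + 5 * (m + W.terrascapeTurns), fun s c c' h hc => ?_⟩
  obtain ⟨q, i, τ⟩ := c
  simp only [TuringMachine.step, civMachine, Option.map_map, Option.map_eq_some_iff] at hc
  obtain ⟨k, hk, rfl⟩ := hc
  obtain ⟨hk₁, hk₂⟩ := table_fits hk
  obtain ⟨s₁, h₁, h₁'⟩ := (h.holds hW).tapeCommand hW k hk₁
  obtain ⟨s₂, h₂, h₂'⟩ := h₁'.move hW k k.dir
  obtain ⟨s₃, h₃, h₃'⟩ := h₂'.stateCommand hW hm k hk₂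
  have hcost := table_cost hk hW.roadTurns_pos hW.terrascapeTurns_pos
  have hM := hW.roadTurns_pos
  have htape : k.tape.cost W.roadTurns ≤ W.roadTurns + 1 := by
    cases k.tape <;> simp only [TapeCommand.cost] <;> omega
  obtain ⟨os, hP, hplay, hlen, hwork⟩ := ((h₁.trans h₂).trans h₃).mono
    (a' := W.roadTurns + 1 + 1 + 5 * (m + W.terrascapeTurns))
    (b' := 5 * W.terrascapeTurns + W.roadTurns) (fun _ h => h) (by omega) (by omega)
  exact ⟨k, os, s₃, hk, hP, hplay, h₃'.represents hW, hlen, hwork⟩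

/-- Every initial configuration is represented by a state of the game. -/
theorem exists_represents_init (hW : W.Suitable) (x : List TileSymbol × List TileSymbol) :
    ∃ s : GameState, Represents W s (civMachine.init x) ∧
      ∀ t ∈ W.stateSection, s.board.improvement t = .none := by
  classical
  obtain ⟨t₀, ht₀⟩ : W.stateSection.Nonempty := by
    have h := Finset.card_pos.mp (Nat.lt_of_lt_of_le (by omega) hW.nine_worked)
    exact h.mono Finset.inter_subset_left
  let c := civMachine.init x
  let g : Tile → Improvement := fun t =>
    if h : ∃ i, W.strip i = t then (c.tape h.choose).improvement else .none
  have hg (i : ℤ) : g (W.strip i) = (c.tape i).improvement := by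
    have h : ∃ j, W.strip j = W.strip i := ⟨i, rfl⟩
    simp only [g, dif_pos h, hW.strip_injective h.choose_spec]
  have hs (t : Tile) (ht : t ∈ W.stateSection) : g t = .none := by
    refine dif_neg ?_
    rintro ⟨i, rfl⟩
    exact hW.section_disjoint i ht
  have hT (t : Tile) : g t ≠ .terrascape := by
    simp only [g]
    split_ifs with h
    · cases c.tape h.choose <;> simp [TileSymbol.improvement]
    · simp
  refine ⟨⟨⟨g, fun _ _ => 0⟩, t₀, W.strip 0, W.strip 0⟩, ?_, hs⟩
  refine Holds.represents hW (q := 0) ⟨?_, hg, rfl, rfl, ht₀, fun t ht => absurd ht (hT t),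
    fun t ht => .inl (hs t (Finset.mem_inter.mp ht).1)⟩
  simp [World.terrascapes, hT]

end CivBE

theorem theorem1 (W : CivBE.World) (hW : W.Suitable) :
    -- the machine of the command table is a (10, 3)-universal Turing machine
    CivBE.IsUTM 10 3 CivBE.civMachine ∧
    -- its transition table is, entry by entry, that of Rogozhin's machine
    (∀ (q : Fin 10) (a : CivBE.TileSymbol),
      CivBE.rogozhin.δ q (CivBE.TileSymbol.equivRSymbol a) =
        (CivBE.civMachine.δ q a).map
          fun (q', a', d) => (q', CivBE.TileSymbol.equivRSymbol a', d)) ∧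
    -- every initial configuration is represented by a state of the game, with the state
    -- section unimproved
    (∀ x : List CivBE.TileSymbol × List CivBE.TileSymbol, ∃ s : CivBE.GameState,
      CivBE.Represents W s (CivBE.civMachine.init x) ∧
        ∀ t ∈ W.stateSection, s.board.improvement t = CivBE.Improvement.none) ∧
    -- the game executes every step of the machine by the commands of the table, in a bounded
    -- number of turns, of which at most `5T + M` are spent on work
    ∃ K : ℕ, ∀ (s : CivBE.GameState) (c c' : CivBE.Cfg (Fin 10) CivBE.TileSymbol),
      CivBE.Represents W s c → CivBE.civMachine.step c = some c' →
      ∃ (k : CivBE.Command) (os : List CivBE.Orders) (s' : CivBE.GameState),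
        CivBE.table c.state (c.tape c.head) = some k ∧
        (∀ o ∈ os, k.Permits o) ∧
        CivBE.Play W s os s' ∧ CivBE.Represents W s' c' ∧
        os.length ≤ K ∧
        (os.filter CivBE.Orders.isWork).length ≤ 5 * W.terrascapeTurns + W.roadTurns := by
  exact ⟨CivBE.isUTM_civMachine, CivBE.rogozhin_δ, CivBE.exists_represents_init hW,
    CivBE.exists_play_of_step hW⟩
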